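/- **Setting.** Let $f=\frac1n\sum_{i=1}^n f_i$ on $\mathbb{R}^d$, $n\ge 1$, where each $f_i$ is convex and $L$-smooth (differentiable with $L$-Lipschitz gradient), $L>0$, and $f$ has a minimizer. Let $\epsilon>0$, $\beta>1$, $x_0\in\mathbb{R}^d$. **Algorithm R-Acc-SVRG-G** (inputs: the $f_i$, $L$, $\epsilon$, $\beta$, $x_0$). Put $\delta_0=L$. For $t=0,1,2,\dots$: let $f_i^{\delta_t}(x)=f_i(x)+\frac{\delta_t}{2}\|x-x_0\|^2$, $f^{\delta_t}=\frac1n\sum_i f_i^{\delta_t}$, $p=\frac1n$, let $\alpha$ be the unique positive root of $\left(1-\frac{p(\alpha+\delta_t)}{\alpha+L+\delta_t}\right)\left(1+\frac{\delta_t}{\alpha}\right)^2=1$, and let $$\tau_x=\frac{\alpha+\delta_t}{\alpha+L+\delta_t},\qquad \tau_z=\frac{\tau_x}{\delta_t}-\frac{\alpha(1-\tau_x)}{\delta_t L},\qquad C=2L+\frac{2L\alpha^2p}{(L+(1-p)(\alpha+\delta_t))\delta_t}.$$ Start from $z_0=\tilde x_0=x_0$ and, for $k=0,1,2,\dots$,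 do the following. - $y_k=\tau_x z_k+(1-\tau_x)\tilde x_k+\tau_z\big(\delta_t(\tilde x_k-z_k)-\nabla f^{\delta_t}(\tilde x_k)\big)$. - Draw $i_k$ uniformly from $\{1,\dots,n\}$, put $G_k=\nabla f^{\delta_t}_{i_k}(y_k)-\nabla f^{\delta_t}_{i_k}(\tilde x_k)+\nabla f^{\delta_t}(\tilde x_k)$ and $z_{k+1}=\arg\min_x\{\langle G_k,x\rangle+\frac{\alpha}{2}\|x-z_k\|^2+\frac{\delta_t}{2}\|x-y_k\|^2\}$. - $\tilde x_{k+1}=y_k$ with probability $p$, and $\tilde x_{k+1}=\tilde x_k$ otherwise. - If $\|\nabla f(\tilde x_k)\|\le\epsilon$, output $\tilde x_k$ and terminate the algorithm. - If $(1+\frac{\delta_t}{\alpha})^k\ge\sqrt{C/(2\delta_t)}$, break the inner loop. After a break put $\delta_{t+1}=\delta_t/\beta$ and go on with outer iteration $t+1$. All random draws are independent. The oracle complexity is the number of evaluations of component gradients $\nabla f_i$: $n$ at the start of every outer iteration that is entered, $2$ in every inner iteration that is executed, and $n$ more in every executed inner iteration with $\tilde x_{k+1}=y_k$. **Theorem (IFC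 case).** Let $\Delta_0>0$ satisfy $f(x_0)-f(x^\star)\le\Delta_0$ for a minimizer $x^\star$ of $f$, let $q\in(0,1)$, let $\delta^\star=\frac{\epsilon^2q^2}{8\Delta_0}$, and let $\ell$ be the first outer iteration index with $\delta_\ell\le\delta^\star$. ($\Delta_0$ and $q$ are not inputs of the algorithm.) (i) Conditionally on entering outer iteration $\ell$ (if this has positive probability), the algorithm terminates in outer iteration $\ell$ with probability at least $1-q$. Consequently it terminates no later than in outer iteration $\ell$ with probability at least $1-q$. (ii) Let $r=\frac{\sqrt{L\Delta_0}}{\epsilon q}$. The total expected oracle complexity of the outer iterations $0,\dots,\ell$ is $$O\left(\left(n\log r+\frac{\sqrt{nL\Delta_0}}{\epsilon q}\right)\log r\right)$$ in the following sense. For every $c>1$ this bound holds whenever $r\ge c$, with a constant that depends only on $\beta$ and $c$. Moreover, whenever $\delta^\star\le L$ it holds with $\log r$ replaced by $\max\{1,\log r\}$ in both places, with a constant that depends only on $\beta$. -/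

import Mathlib

open MeasureTheory ProbabilityTheory
open scoped Gradient ENNReal

namespace RAccSVRG

/-- The space `ℝ^d` with the Euclidean norm and inner product. -/
abbrev Vec (d : ℕ) := EuclideanSpace ℝ (Fin d)

/-- `g` is differentiable with `L`-Lipschitz gradient. -/
def LSmooth {d : ℕ} (L : ℝ) (g : Vec d → ℝ) : Prop :=
  Differentiable ℝ g ∧ ∀ x y : Vec d, ‖∇ g x - ∇ g y‖ ≤ L * ‖x - y‖

/-- The finite sum `(1/n) ∑ i, f_i`. -/
noncomputable def average {n d : ℕ} (f : Fin n → Vec d → ℝ) (x : Vec d) : ℝ :=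
  (1 / (n : ℝ)) * ∑ i, f i x

/-- The regularized component `g(x) + (δ/2) ‖x - x₀‖²`. -/
noncomputable def regularize {d : ℕ} (δ : ℝ) (x₀ : Vec d) (g : Vec d → ℝ) (x : Vec d) : ℝ :=
  g x + δ / 2 * ‖x - x₀‖ ^ 2

section Parameters

/-- `a` is a positive root of the equation that determines the parameter `α`
(with `p = 1 / n`). -/
def IsPosRoot (n : ℕ) (L δ a : ℝ) : Prop :=
  0 < a ∧ (1 - (1 / (n : ℝ)) * (a + δ) / (a + L + δ)) * (1 + δ / a) ^ 2 = 1

theorem existsUnique_isPosRoot {n : ℕ} {L δ : ℝ} (hn : 0 < n) (hL : 0 < L) (hδ : 0 < δ) :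
    ∃! a, IsPosRoot n L δ a := by
  have hn1 : (1 : ℝ) ≤ n := by exact_mod_cast hn
  have hn0 : (0 : ℝ) < n := by linarith
  have key : ∀ a : ℝ, 0 < a →
      ((1 - (1 / (n : ℝ)) * (a + δ) / (a + L + δ)) * (1 + δ / a) ^ 2 = 1 ↔
        (n * (a + L + δ) - (a + δ)) * (a + δ) ^ 2 - n * a ^ 2 * (a + L + δ) = 0) := by
    intro a ha
    have h1 : a + L + δ ≠ 0 := by positivity
    have h2 : a ≠ 0 := ha.ne'
    have e : (1 - (1 / (n : ℝ)) * (a + δ) / (a + L + δ)) * (1 + δ / a) ^ 2 - 1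
        = ((n * (a + L + δ) - (a + δ)) * (a + δ) ^ 2 - n * a ^ 2 * (a + L + δ))
          / (n * a ^ 2 * (a + L + δ)) := by
      field_simp
    have h3 : (n : ℝ) * a ^ 2 * (a + L + δ) ≠ 0 := by positivity
    rw [← sub_eq_zero, e, div_eq_zero_iff]
    simp [h3]
  have hex : ∃ a, IsPosRoot n L δ a := by
    set s : ℝ → ℝ := fun a =>
      (n * (a + L + δ) - (a + δ)) * (a + δ) ^ 2 - n * a ^ 2 * (a + L + δ) with hs
    have hc : ContinuousOn s (Set.Icc 0 (2 * n * δ + L)) := by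
      apply Continuous.continuousOn; simp only [hs]; fun_prop
    have h0 : 0 < s 0 := by
      have : 0 < (n : ℝ) * (L + δ) - δ := by nlinarith
      simp only [hs]
      have h2 : 0 < ((n : ℝ) * (L + δ) - δ) * δ ^ 2 := by positivity
      simpa using h2
    have hM : s (2 * n * δ + L) < 0 := by
      have e : s (2 * n * δ + L) =
          -(n * δ ^ 2 * (2 * n * δ + L + δ + L)
            + (2 * n * δ + L + δ) * ((2 * n * δ + L + δ) * (L + δ) - 2 * n * δ * L)) := by
        simp only [hs]; ring
      have : 0 < (2 * n * δ + L + δ) * (L + δ) - 2 * n * δ * L := by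
        have : (2 * n * δ + L + δ) * (L + δ) - 2 * n * δ * L
          = 2 * n * δ ^ 2 + (L + δ) ^ 2 := by ring
        rw [this]; positivity
      rw [e]
      have : 0 < n * δ ^ 2 * (2 * n * δ + L + δ + L)
            + (2 * n * δ + L + δ) * ((2 * n * δ + L + δ) * (L + δ) - 2 * n * δ * L) := by
        positivity
      linarith
    obtain ⟨a, ha, hsa⟩ := intermediate_value_Icc' (by positivity) hc ⟨hM.le, h0.le⟩
    have hapos : 0 < a := by
      rcases ha.1.lt_or_eq with h | h
      · exact h
      · rw [← h] at hsa; linarith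
    exact ⟨a, hapos, (key a hapos).2 hsa⟩
  have hlt : ∀ a b : ℝ, 0 < a → a < b →
      (1 - (1 / (n : ℝ)) * (b + δ) / (b + L + δ)) * (1 + δ / b) ^ 2 <
      (1 - (1 / (n : ℝ)) * (a + δ) / (a + L + δ)) * (1 + δ / a) ^ 2 := by
    intro a b ha hab
    have hb : 0 < b := ha.trans hab
    have hp : 1 / (n : ℝ) ≤ 1 := by rw [div_le_one hn0]; exact hn1
    have hp0 : 0 < 1 / (n : ℝ) := by positivity
    apply mul_lt_mul''
    · have : (a + δ) / (a + L + δ) < (b + δ) / (b + L + δ) := by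
        rw [div_lt_div_iff₀ (by positivity) (by positivity)]; nlinarith
      have := mul_lt_mul_of_pos_left this hp0
      rw [mul_div_assoc, mul_div_assoc]; linarith
    · have : δ / b < δ / a := div_lt_div_of_pos_left hδ ha hab
      have h0 : 0 < δ / b := by positivity
      exact pow_lt_pow_left₀ (by linarith) (by linarith) (by norm_num)
    · have : (b + δ) / (b + L + δ) ≤ 1 := by
        rw [div_le_one (by positivity)]; linarith
      have h0 : 0 ≤ (b + δ) / (b + L + δ) := by positivity
      rw [mul_div_assoc]; nlinarith
    · positivity
  obtain ⟨a, ha⟩ := hex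
  refine ⟨a, ha, fun b hb => ?_⟩
  rcases lt_trichotomy a b with h | h | h
  · exact absurd (hlt a b ha.1 h) (by rw [ha.2, hb.2]; simp)
  · exact h.symm
  · exact absurd (hlt b a hb.1 h) (by rw [ha.2, hb.2]; simp)

/-- The parameter `α`: the unique positive root. -/
noncomputable def alpha (n : ℕ) (L δ : ℝ) : ℝ :=
  Classical.epsilon (IsPosRoot n L δ)

theorem alpha_spec {n : ℕ} {L δ : ℝ} (hn : 0 < n) (hL : 0 < L) (hδ : 0 < δ) :
    IsPosRoot n L δ (alpha n L δ) :=
  Classical.epsilon_spec (existsUnique_isPosRoot hn hL hδ).exists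

noncomputable def tauX (n : ℕ) (L δ : ℝ) : ℝ :=
  (alpha n L δ + δ) / (alpha n L δ + L + δ)

noncomputable def tauZ (n : ℕ) (L δ : ℝ) : ℝ :=
  tauX n L δ / δ - alpha n L δ * (1 - tauX n L δ) / (δ * L)

noncomputable def CIFC (n : ℕ) (L δ : ℝ) : ℝ :=
  2 * L + 2 * L * alpha n L δ ^ 2 * (1 / (n : ℝ)) /
    ((L + (1 - 1 / (n : ℝ)) * (alpha n L δ + δ)) * δ)

end Parameters

section ProximalStep

/-- The objective minimized in the `z`-update. -/
noncomputable def proxObjective {d : ℕ} (α δ : ℝ) (G z y x : Vec d) : ℝ :=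
  inner ℝ G x + α / 2 * ‖x - z‖ ^ 2 + δ / 2 * ‖x - y‖ ^ 2

/-- The minimizer of `proxObjective α δ G z y`, in closed form. -/
noncomputable def proxStep {d : ℕ} (α δ : ℝ) (G z y : Vec d) : Vec d :=
  (α + δ)⁻¹ • (α • z + δ • y - G)

/-- `proxStep` is the unique minimizer of `proxObjective`. -/
theorem proxObjective_proxStep_lt {d : ℕ} {α δ : ℝ} (hα : 0 < α) (hδ : 0 < δ)
    (G z y x : Vec d) (hx : x ≠ proxStep α δ G z y) :
    proxObjective α δ G z y (proxStep α δ G z y) < proxObjective α δ G z y x := by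
  set w := proxStep α δ G z y with hw
  have hG : G = α • z + δ • y - (α + δ) • w := by
    rw [hw, proxStep, smul_smul, mul_inv_cancel₀ (by positivity), one_smul]; abel
  have e : proxObjective α δ G z y x
      = proxObjective α δ G z y w + (α + δ) / 2 * ‖x - w‖ ^ 2 := by
    simp only [proxObjective, hG, ← real_inner_self_eq_norm_sq, inner_sub_left, inner_sub_right,
      inner_add_left, inner_smul_left, RCLike.conj_to_real]
    rw [real_inner_comm x z, real_inner_comm x y, real_inner_comm x w, real_inner_comm w z,
      real_inner_comm w y]
    ring
  have : 0 < ‖x - w‖ := norm_pos_iff.2 (sub_ne_zero.2 hx)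
  rw [e]
  have : 0 < (α + δ) / 2 * ‖x - w‖ ^ 2 := by positivity
  linarith

end ProximalStep

/-- The input of the algorithm: the components `f_i`, the smoothness constant `L`, the accuracy
`ε`, the parameter `β` and the initial guess `x₀`. -/
structure Input (n d : ℕ) where
  f : Fin n → Vec d → ℝ
  L : ℝ
  ε : ℝ
  β : ℝ
  x₀ : Vec d

/-- The random draws: entry `(t, k)` holds the index `i_k` and the outcome of the coin (`true` for
the update `x̃_{k+1} = y_k`) that are used in inner iteration `k` of outer iteration `t`. -/
abbrev Tape (n : ℕ) := ℕ → ℕ → Fin n × Bool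

namespace Input

variable {n d : ℕ} (A : Input n d)

/-- The regularization parameters: `δ_0 = L`, `δ_{t+1} = δ_t / β`. -/
noncomputable def delta : ℕ → ℝ
  | 0 => A.L
  | t + 1 => delta t / A.β

/-- The regularized components `f_i^{δ_t}`. -/
noncomputable def regF (t : ℕ) (i : Fin n) : Vec d → ℝ :=
  regularize (A.delta t) A.x₀ (A.f i)

/-- The point `y_k` computed from `(z_k, x̃_k)` in outer iteration `t`. -/
noncomputable def yPoint (t : ℕ) (s : Vec d × Vec d) : Vec d :=
  tauX n A.L (A.delta t) • s.1 + (1 - tauX n A.L (A.delta t)) • s.2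
    + tauZ n A.L (A.delta t) • (A.delta t • (s.2 - s.1) - ∇ (average (A.regF t)) s.2)

/-- The variance-reduced gradient estimator `G_k^{δ_t}` for the sampled index `i`. -/
noncomputable def estimator (t : ℕ) (s : Vec d × Vec d) (i : Fin n) : Vec d :=
  ∇ (A.regF t i) (A.yPoint t s) - ∇ (A.regF t i) s.2 + ∇ (average (A.regF t)) s.2

/-- The pair `(z_k, x̃_k)` of the inner loop in outer iteration `t`, for the draws `ω`. -/
noncomputable def inner (ω : Tape n) (t : ℕ) : ℕ → Vec d × Vec d
  | 0 => (A.x₀, A.x₀)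
  | k + 1 =>
    let s := inner ω t k
    (proxStep (alpha n A.L (A.delta t)) (A.delta t) (A.estimator t s (ω t k).1) s.1 (A.yPoint t s),
      if (ω t k).2 then A.yPoint t s else s.2)

/-- The termination test of inner iteration `k` of outer iteration `t`: `‖∇f(x̃_k)‖ ≤ ε`. -/
def Stops (ω : Tape n) (t k : ℕ) : Prop :=
  ‖∇ (average A.f) (A.inner ω t k).2‖ ≤ A.ε

/-- The test (under IFC) for breaking the inner loop of outer iteration `t` at iteration `k`. -/
def Breaks (t k : ℕ) : Prop :=
  √(CIFC n A.L (A.delta t) / (2 * A.delta t)) ≤ (1 + A.delta t / alpha n A.L (A.delta t)) ^ k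

/-- Once outer iteration `t` is entered, inner iteration `k` is executed: no earlier inner
iteration terminated the algorithm or broke the loop. -/
def Executes (ω : Tape n) (t k : ℕ) : Prop :=
  ∀ j < k, ¬ A.Stops ω t j ∧ ¬ A.Breaks t j

/-- The algorithm enters outer iteration `t`: every earlier inner loop was left by a break. In one
inner iteration the termination test comes before the test for a break. -/
def Reaches (ω : Tape n) : ℕ → Prop
  | 0 => True
  | t + 1 => Reaches ω t ∧ ∃ k, A.Executes ω t k ∧ ¬ A.Stops ω t k ∧ A.Breaks t k

/-- The algorithm outputs a point and terminates during outer iteration `t`. -/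
def TerminatesAt (ω : Tape n) (t : ℕ) : Prop :=
  A.Reaches ω t ∧ ∃ k, A.Executes ω t k ∧ A.Stops ω t k

open Classical in
/-- The number of evaluations of component gradients `∇f_i` in outer iteration `t`: `n` for the
full gradient at `x̃_0 = x₀`, and for every executed inner iteration two for the estimator and `n`
more for the full gradient at the new point if `x̃_{k+1} = y_k`. -/
noncomputable def outerCalls (ω : Tape n) (t : ℕ) : ℝ≥0∞ :=
  if A.Reaches ω t then
    n + ∑' k, if A.Executes ω t k then 2 + (if (ω t k).2 then (n : ℝ≥0∞) else 0) else 0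
  else 0

/-- The number of evaluations of component gradients in the outer iterations `0, …, ℓ`. -/
noncomputable def totalCalls (ω : Tape n) (ℓ : ℕ) : ℝ≥0∞ :=
  ∑ t ∈ Finset.range (ℓ + 1), A.outerCalls ω t

/-- The assumptions on the input: `n ≥ 1` convex and `L`-smooth components, `L > 0`, `ε > 0`,
`β > 1`. -/
structure Admissible : Prop where
  n_pos : 0 < n
  L_pos : 0 < A.L
  ε_pos : 0 < A.ε
  β_gt : 1 < A.β
  convex : ∀ i, ConvexOn ℝ Set.univ (A.f i)
  smooth : ∀ i, LSmooth A.L (A.f i)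

/-- The initial bounded-function condition: `f` has a minimizer `x⋆`, and
`f(x₀) - f(x⋆) ≤ Δ₀`. -/
def IFC (Δ₀ : ℝ) : Prop :=
  ∃ xs : Vec d, (∀ x, average A.f xs ≤ average A.f x) ∧ average A.f A.x₀ - average A.f xs ≤ Δ₀

end Input

/-- The draws `ξ t k` are independent, and each is a uniform index in `Fin n` together with an
independent coin that shows `true` with probability `1 / n`. -/
structure IsSampling {n : ℕ} {Ω : Type*} [MeasurableSpace Ω] (P : Measure Ω)
    (ξ : ℕ → ℕ → Ω → Fin n × Bool) : Prop where
  measurable : ∀ t k, Measurable (ξ t k)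
  law : ∀ t k i b, P.real (ξ t k ⁻¹' {(i, b)}) =
    (1 / (n : ℝ)) * (if b then 1 / (n : ℝ) else 1 - 1 / (n : ℝ))
  indep : iIndepFun (fun s : ℕ × ℕ => ξ s.1 s.2) P

end RAccSVRG

/-! Fix an outer iteration with `δ = δ_t` and let `xs` be the minimizer of `f^δ`, so that `∇f(xs) =
δ (x₀ - xs)`. The potential is the Bregman divergence of the unregularized `f` between `x̃` and
`xs`, plus a multiple of `‖z - xs‖²`. Written relative to `xs`, the regularizer cancels from the
recursions for `y` and `z` except through the coefficients. Averaging over index and coin, the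
divergence part scales by `1 - pτ_x` and the distance part by `(α/(α+δ))²`; the equation for `α`
says that these factors agree. What remains is nonpositive by convexity of `f` and cocoercivity of
each `∇f_i` (`lyapunov_inequality`, `sum_drawProb_lyapunov_step_le`).

The identity `D_f(x₀, xs) + δ‖x₀ - xs‖² = f(x₀) - f(xs) ≤ Δ₀` bounds both `‖∇f(xs)‖²` by `δΔ₀` and
the initial potential by `CΔ₀/(2L)`. The break test, squared, says `C ρ^k ≤ 2δ` for the contraction
factor `ρ`, so `E‖∇f(x̃_k) - ∇f(xs)‖² ≤ 2δΔ₀` at the break. Once `δ ≤ δ⋆`, Markov's inequality makes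
the termination test fail there with probability at most `q` (`measure_not_stops_le`).

The tape holds a draw for every `(t, k)`, executed or not, so the inner iterates of every outer
iteration are defined unconditionally. Entering iteration `ℓ` depends only on earlier rows of the
tape and the test in iteration `ℓ` only on row `ℓ`; independence then gives the conditional
statement.

For the complexity, the root equation gives `(α+δ)/δ ≤ 2n + √(2nL/δ)`, which bounds the number of
inner iterations up to the break by this quantity times a logarithm of `L/δ`. An inner iteration
costs at most `2 + n · (1/n) = 3` in expectation. Since `L/δ_t = β^t`, the square roots form a
geometric sum dominated by its last term, and minimality of `ℓ` gives `β^ℓ ≤ 8βr²`. -/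

namespace RAccSVRG

/-! ### Convex functions with Lipschitz gradient. -/

section ConvexSmooth

variable {d : ℕ} {g : Vec d → ℝ} {L : ℝ}

theorem hasDerivAt_comp_segment (hg : Differentiable ℝ g) (x v : Vec d) (t : ℝ) :
    HasDerivAt (fun s : ℝ => g (x + s • v)) (inner ℝ (∇ g (x + t • v)) v) t := by
  have h1 : HasDerivAt (fun s : ℝ => x + s • v) v t := by
    simpa using ((hasDerivAt_id t).smul_const v).const_add x
  have h2 := (hg (x + t • v)).hasGradientAt.hasFDerivAt.comp_hasDerivAt t h1
  rw [← hasDerivWithinAt_univ] at h2 ⊢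
  simpa [Function.comp_def] using h2

/-- The first-order characterization of convexity. -/
theorem gradient_inequality (hc : ConvexOn ℝ Set.univ g) (hg : Differentiable ℝ g) (x y : Vec d) :
    g x + inner ℝ (∇ g x) (y - x) ≤ g y := by
  have hd := hasDerivAt_comp_segment hg x (y - x) 0
  have hcx : ConvexOn ℝ Set.univ (fun s : ℝ => g (x + s • (y - x))) := by
    have := hc.comp_affineMap (AffineMap.lineMap x y)
    refine this.congr fun s _ => ?_
    simp [AffineMap.lineMap_apply, add_comm]
  have := hcx.le_slope_of_hasDerivAt (Set.mem_univ 0) (Set.mem_univ 1) one_pos hd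
  simp [slope_def_field, -inner_gradient_left] at this
  linarith

/-- The quadratic upper bound for functions with a Lipschitz gradient. -/
theorem LSmooth.le_quadratic (hg : LSmooth L g) (x y : Vec d) :
    g y ≤ g x + inner ℝ (∇ g x) (y - x) + L / 2 * ‖y - x‖ ^ 2 := by
  set v := y - x with hv
  set φ : ℝ → ℝ := fun s =>
    g (x + s • v) - s * inner ℝ (∇ g x) v - s ^ 2 * (L / 2 * ‖v‖ ^ 2) with hφ
  have hd : ∀ t, HasDerivAt φ (inner ℝ (∇ g (x + t • v)) v - inner ℝ (∇ g x) v
      - 2 * t * (L / 2 * ‖v‖ ^ 2)) t := by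
    intro t
    have h1 := hasDerivAt_comp_segment hg.1 x v t
    have h2 := (hasDerivAt_id t).mul_const (inner ℝ (∇ g x) v)
    have h3 := (hasDerivAt_pow 2 t).mul_const (L / 2 * ‖v‖ ^ 2)
    refine ((h1.sub h2).sub h3).congr_deriv ?_
    simp [-inner_gradient_left]
  -- `φ` is `g` along the segment minus its claimed upper model, up to the constant `g x`; the
  -- Lipschitz bound makes its derivative nonpositive.
  have hanti : AntitoneOn φ (Set.Icc 0 1) := by
    apply antitoneOn_of_deriv_nonpos (convex_Icc 0 1)
    · exact fun t _ => (hd t).continuousAt.continuousWithinAt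
    · exact fun t _ => (hd t).differentiableAt.differentiableWithinAt
    · intro t ht
      rw [interior_Icc] at ht
      rw [(hd t).deriv, ← inner_sub_left]
      have h1 := real_inner_le_norm (∇ g (x + t • v) - ∇ g x) v
      have h2 := hg.2 (x + t • v) x
      have h3 : ‖x + t • v - x‖ = t * ‖v‖ := by
        rw [add_sub_cancel_left, norm_smul, Real.norm_of_nonneg ht.1.le]
      rw [h3] at h2
      have h4 := mul_le_mul_of_nonneg_right h2 (norm_nonneg v)
      nlinarith
  have := hanti (Set.left_mem_Icc.2 zero_le_one) (Set.right_mem_Icc.2 zero_le_one) zero_le_one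
  simp only [hφ, hv] at this
  simp [-inner_gradient_left] at this
  rw [hv]
  linarith

/-- The Bregman divergence of a convex smooth function dominates the gradient difference. -/
theorem LSmooth.sq_norm_gradient_sub_le (hL : 0 < L) (hg : LSmooth L g)
    (hc : ConvexOn ℝ Set.univ g) (x u : Vec d) :
    ‖∇ g x - ∇ g u‖ ^ 2 ≤ 2 * L * (g x - g u - inner ℝ (∇ g u) (x - u)) := by
  set D := ∇ g x - ∇ g u with hD
  -- Compare the upper model at `x` with the tangent plane at `u`, at the point reached from `x` by
  -- a gradient step for `g - ⟨∇g(u), ·⟩`.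
  have h1 := hg.le_quadratic x (x - L⁻¹ • D)
  have h2 := gradient_inequality hc hg.1 u (x - L⁻¹ • D)
  have e1 : x - L⁻¹ • D - x = -(L⁻¹ • D) := by abel
  have e2 : x - L⁻¹ • D - u = (x - u) - L⁻¹ • D := by abel
  rw [e1, norm_neg, norm_smul, inner_neg_right, inner_smul_right, Real.norm_of_nonneg
    (by positivity)] at h1
  rw [e2, inner_sub_right, inner_smul_right] at h2
  have e3 : inner ℝ (∇ g x) D - inner ℝ (∇ g u) D = ‖D‖ ^ 2 := by
    rw [← inner_sub_left, ← hD, real_inner_self_eq_norm_sq]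
  have e4 : L / 2 * (L⁻¹ * ‖D‖) ^ 2 = L⁻¹ * ‖D‖ ^ 2 / 2 := by field_simp
  rw [e4] at h1
  have h3 : L⁻¹ * ‖D‖ ^ 2 / 2 ≤ g x - g u - inner ℝ (∇ g u) (x - u) := by
    rw [← e3] at h1 ⊢
    nlinarith
  calc ‖D‖ ^ 2 = 2 * L * (L⁻¹ * ‖D‖ ^ 2 / 2) := by field_simp
    _ ≤ _ := by gcongr

end ConvexSmooth

/-! ### Finite averages and quadratic regularization. -/

section Average

variable {n d : ℕ} {f : Fin n → Vec d → ℝ} {L : ℝ}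

theorem hasGradientAt_average (hf : ∀ i, Differentiable ℝ (f i)) (x : Vec d) :
    HasGradientAt (average f) ((1 / (n : ℝ)) • ∑ i, ∇ (f i) x) x := by
  rw [hasGradientAt_iff_hasFDerivAt, map_smul, map_sum]
  have h := HasFDerivAt.fun_sum (u := Finset.univ)
    fun i _ => ((hf i) x).hasGradientAt.hasFDerivAt
  exact h.const_mul _

theorem gradient_average (hf : ∀ i, Differentiable ℝ (f i)) (x : Vec d) :
    ∇ (average f) x = (1 / (n : ℝ)) • ∑ i, ∇ (f i) x :=
  (hasGradientAt_average hf x).gradient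

theorem LSmooth.average (hn : 0 < n) (hf : ∀ i, LSmooth L (f i)) :
    LSmooth L (average f) := by
  have hd := fun i => (hf i).1
  have hn0 : (0 : ℝ) < n := by exact_mod_cast hn
  refine ⟨fun x => (hasGradientAt_average hd x).differentiableAt, fun x y => ?_⟩
  rw [gradient_average hd, gradient_average hd, ← smul_sub, ← Finset.sum_sub_distrib, norm_smul,
    Real.norm_of_nonneg (by positivity)]
  have : ‖∑ i, (∇ (f i) x - ∇ (f i) y)‖ ≤ n * (L * ‖x - y‖) := by
    refine (norm_sum_le _ _).trans ((Finset.sum_le_sum fun i _ => (hf i).2 x y).trans ?_)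
    simp
  calc 1 / (n : ℝ) * _ ≤ 1 / (n : ℝ) * (n * (L * ‖x - y‖)) := by gcongr
    _ = _ := by field_simp

theorem convexOn_average (hf : ∀ i, ConvexOn ℝ Set.univ (f i)) :
    ConvexOn ℝ Set.univ (average f) := by
  have h : ConvexOn ℝ Set.univ (fun x => ∑ i, f i x) := by
    refine ⟨convex_univ, fun x _ y _ a b ha hb hab => ?_⟩
    simp only [smul_eq_mul, Finset.mul_sum, ← Finset.sum_add_distrib]
    exact Finset.sum_le_sum fun i _ => (hf i).2 (Set.mem_univ x) (Set.mem_univ y) ha hb hab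
  exact h.smul (by positivity : (0 : ℝ) ≤ 1 / n)

theorem hasGradientAt_regularize {g : Vec d → ℝ} (hg : Differentiable ℝ g) (δ : ℝ)
    (x₀ x : Vec d) : HasGradientAt (regularize δ x₀ g) (∇ g x + δ • (x - x₀)) x := by
  rw [hasGradientAt_iff_hasFDerivAt, map_add]
  have h := ((hasFDerivAt_id x).sub_const x₀).norm_sq.const_mul (δ / 2)
  refine ((hg x).hasGradientAt.hasFDerivAt.add h).congr_fderiv ?_
  ext v
  simp
  ring

theorem average_regularize (hn : 0 < n) (δ : ℝ) (x₀ : Vec d) :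
    average (fun i => regularize δ x₀ (f i)) = regularize δ x₀ (average f) := by
  have hn0 : (n : ℝ) ≠ 0 := by exact_mod_cast hn.ne'
  ext x
  simp only [average, regularize, Finset.sum_add_distrib, Finset.sum_const, Finset.card_univ,
    Fintype.card_fin, nsmul_eq_mul]
  field_simp

/-- A regularized function that is bounded below has a minimizer, characterized by its gradient. -/
theorem exists_gradient_eq_smul_sub {F : Vec d → ℝ} (hF : Differentiable ℝ F) {m δ : ℝ}
    (hm : ∀ x, m ≤ F x) (hδ : 0 < δ) (x₀ : Vec d) :
    ∃ xs, ∇ F xs = δ • (x₀ - xs) := by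
  have hcont : Continuous (regularize δ x₀ F) := by
    have := hF.continuous
    unfold regularize
    fun_prop
  have hlim : Filter.Tendsto (regularize δ x₀ F) (Filter.cocompact _) Filter.atTop := by
    have h1 : Filter.Tendsto (fun x : Vec d => ‖x - x₀‖) (Filter.cocompact _) Filter.atTop := by
      have := tendsto_dist_right_cocompact_atTop x₀
      simpa [dist_eq_norm] using this
    have h2 : Filter.Tendsto (fun x : Vec d => m + δ / 2 * ‖x - x₀‖ ^ 2)
        (Filter.cocompact _) Filter.atTop :=
      Filter.tendsto_atTop_add_const_left _ _
        (((Filter.tendsto_pow_atTop two_ne_zero).comp h1).const_mul_atTop (by positivity))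
    exact Filter.tendsto_atTop_mono (fun x => by unfold regularize; gcongr; exact hm x) h2
  obtain ⟨xs, hxs⟩ := hcont.exists_forall_le hlim
  have h0 : fderiv ℝ (regularize δ x₀ F) xs = 0 :=
    IsLocalMin.fderiv_eq_zero (Filter.Eventually.of_forall hxs)
  have h1 := (hasGradientAt_regularize hF δ x₀ xs).gradient
  rw [gradient, h0, map_zero] at h1
  refine ⟨xs, ?_⟩
  rw [eq_neg_of_add_eq_zero_left h1.symm, ← smul_neg, neg_sub]

end Average

/-! ### Ingredients of the potential and identities between the parameters. -/

/-- The Bregman divergence of `g` at `u`. -/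
noncomputable def bregman {d : ℕ} (g : Vec d → ℝ) (u x : Vec d) : ℝ :=
  g x - g u - inner ℝ (∇ g u) (x - u)

/-- The weight of `‖z - x⋆‖² / 2` in the Lyapunov function. -/
noncomputable def lyapunovWeight (n : ℕ) (L δ : ℝ) : ℝ :=
  1 / (n : ℝ) * (alpha n L δ + δ) ^ 2 / (alpha n L δ + L + δ)

/-- The contraction factor of one inner iteration. -/
noncomputable def contraction (n : ℕ) (L δ : ℝ) : ℝ :=
  (alpha n L δ / (alpha n L δ + δ)) ^ 2

/-- The probability of an index and a coin outcome in one inner iteration. -/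
noncomputable def drawProb (n : ℕ) (b : Fin n × Bool) : ℝ :=
  (1 / (n : ℝ)) * (if b.2 then 1 / (n : ℝ) else 1 - 1 / (n : ℝ))

section Parameters

variable {n : ℕ} {L δ : ℝ}

theorem alpha_pos (hn : 0 < n) (hL : 0 < L) (hδ : 0 < δ) : 0 < alpha n L δ :=
  (alpha_spec hn hL hδ).1

/-- This is the defining equation of `α`: `(1 + δ/α)²` is the reciprocal of the contraction factor.
Each form serves one half of the potential. -/
theorem contraction_eq (hn : 0 < n) (hL : 0 < L) (hδ : 0 < δ) :
    contraction n L δ = 1 - 1 / (n : ℝ) * (alpha n L δ + δ) / (alpha n L δ + L + δ) := by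
  obtain ⟨h1, h2⟩ := alpha_spec hn hL hδ
  have h3 : (1 + δ / alpha n L δ) ^ 2 * contraction n L δ = 1 := by
    rw [contraction, ← mul_pow]
    have : (1 + δ / alpha n L δ) * (alpha n L δ / (alpha n L δ + δ)) = 1 := by field_simp
    rw [this, one_pow]
  calc contraction n L δ = (1 - 1 / (n : ℝ) * (alpha n L δ + δ) / (alpha n L δ + L + δ))
        * ((1 + δ / alpha n L δ) ^ 2 * contraction n L δ) := by rw [← mul_assoc, h2, one_mul]
    _ = _ := by rw [h3, mul_one]

theorem contraction_pos (hn : 0 < n) (hL : 0 < L) (hδ : 0 < δ) : 0 < contraction n L δ := by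
  have := alpha_pos hn hL hδ
  unfold contraction
  positivity

theorem contraction_pow (k : ℕ) :
    contraction n L δ ^ k = ((alpha n L δ / (alpha n L δ + δ)) ^ k) ^ 2 := by
  rw [contraction, ← pow_mul, ← pow_mul, mul_comm]

theorem lyapunovWeight_pos (hn : 0 < n) (hL : 0 < L) (hδ : 0 < δ) :
    0 < lyapunovWeight n L δ := by
  have := alpha_pos hn hL hδ
  have : (0 : ℝ) < n := by exact_mod_cast hn
  unfold lyapunovWeight
  positivity

/-- The root equation turns `α²p / (L + (1-p)(α+δ))` into the Lyapunov weight, which explains the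
constant in the break test: it compares the potential at `x₀` with `f(x₀) - f(xs)`. -/
theorem CIFC_eq (hn : 0 < n) (hL : 0 < L) (hδ : 0 < δ) :
    CIFC n L δ = 2 * L + 2 * L * lyapunovWeight n L δ / δ := by
  have ha := alpha_pos hn hL hδ
  have hn0 : (0 : ℝ) < n := by exact_mod_cast hn
  have hn1 : (1 : ℝ) ≤ n := by exact_mod_cast hn
  have h := contraction_eq hn hL hδ
  rw [contraction] at h
  rw [CIFC, lyapunovWeight]
  set a := alpha n L δ
  have hD : 0 < L + (1 - 1 / (n : ℝ)) * (a + δ) := by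
    have : 1 / (n : ℝ) ≤ 1 := by rw [div_le_one hn0]; exact hn1
    have : 0 ≤ (1 - 1 / (n : ℝ)) * (a + δ) := mul_nonneg (by linarith) (by positivity)
    linarith
  have key : a ^ 2 * (a + L + δ) = (a + δ) ^ 2 * (L + (1 - 1 / (n : ℝ)) * (a + δ)) := by
    rw [div_pow, div_eq_iff (by positivity)] at h
    rw [h]
    field_simp
    ring
  congr 1
  rw [div_eq_div_iff (by positivity) (by positivity)]
  have : 2 * L * a ^ 2 * (1 / (n : ℝ)) * δ = (2 * L * (1 / (n : ℝ)) * δ) * a ^ 2 := by ring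
  field_simp
  field_simp at key
  linear_combination key

theorem tauZ_eq (hn : 0 < n) (hL : 0 < L) (hδ : 0 < δ) :
    tauZ n L δ = 1 / (alpha n L δ + L + δ) := by
  have ha := alpha_pos hn hL hδ
  rw [tauZ, tauX]
  field_simp
  ring

end Parameters

/-! ### The deterministic inequality behind one inner iteration. -/

section LyapunovStep

variable {E : Type*} [NormedAddCommGroup E] [InnerProductSpace ℝ E]

/-- The one-step decrease of the Lyapunov function, with the averages over the index and the coin
written out: `S` is the mean square of the recentered estimator. -/
theorem lyapunov_inequality {α δ L p ρ hx hy S : ℝ} {a b X Y Z : E} (hα : 0 < α) (hδ : 0 < δ)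
    (hL : 0 < L) (hp : 0 ≤ p) (hρ : ρ = (α / (α + δ)) ^ 2)
    (hρ' : ρ = 1 - p * (α + δ) / (α + L + δ))
    (hY : (α + L + δ) • Y = α • Z + L • X - b) (hyY : hy ≤ inner ℝ a Y)
    (hS : S ≤ 2 * L * (hx - hy - inner ℝ a (X - Y)) + 2 * inner ℝ a b - ‖b‖ ^ 2) :
    p * hy + (1 - p) * hx + p * (α + δ) ^ 2 / (α + L + δ) / 2 *
        (((α + δ) ^ 2)⁻¹ * (α ^ 2 * ‖Z‖ ^ 2 - 2 * α * inner ℝ a Z + S))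
      ≤ ρ * (hx + p * (α + δ) ^ 2 / (α + L + δ) / 2 * ‖Z‖ ^ 2) := by
  have hZ : α * inner ℝ a Z = (α + L + δ) * inner ℝ a Y - L * inner ℝ a X + inner ℝ a b := by
    have := congrArg (fun w => inner ℝ a w) hY
    simp only [inner_add_right, inner_sub_right, inner_smul_right] at this
    linarith
  rw [inner_sub_right] at hS
  set M := α + L + δ with hM
  have hMpos : 0 < M := by positivity
  set c := inner ℝ a Z
  have e1 : p * (α + δ) ^ 2 / M / 2 * (((α + δ) ^ 2)⁻¹ * (α ^ 2 * ‖Z‖ ^ 2 - 2 * α * c + S))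
      = ρ * (p * (α + δ) ^ 2 / M / 2 * ‖Z‖ ^ 2) + p / M * (S / 2 - α * c) := by
    rw [hρ]
    field_simp
    ring
  have e2 : p * hy + (1 - p) * hx = ρ * hx + p / M * (M * hy - L * hx) := by
    rw [hρ']
    field_simp
    rw [hM]
    ring
  -- After inserting `hZ` and `hS`, the terms in `hx`, `X` and `⟪a, b⟫` cancel. This cancellation is
  -- the purpose of the gradient term in `y`. The bound left is `(M - L)(hy - ⟪a, Y⟫) - ‖b‖²/2`.
  have key : M * hy - L * hx + (S / 2 - α * c) ≤ 0 := by
    rw [hZ]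
    have : (M - L) * (hy - inner ℝ a Y) ≤ 0 :=
      mul_nonpos_of_nonneg_of_nonpos (by rw [hM]; linarith) (by linarith)
    nlinarith [sq_nonneg ‖b‖]
  have : p / M * (M * hy - L * hx + (S / 2 - α * c)) ≤ 0 :=
    mul_nonpos_of_nonneg_of_nonpos (by positivity) key
  rw [e1, e2]
  linarith

end LyapunovStep

/-! ### Contraction of the potential, averaged over one draw. -/

namespace Input

variable {n d : ℕ} {A : Input n d}

/-- One inner iteration of outer iteration `t` from `(z_k, x̃_k)` with the draw `b`. -/
noncomputable def step (A : Input n d) (t : ℕ) (s : Vec d × Vec d) (b : Fin n × Bool) :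
    Vec d × Vec d :=
  (proxStep (alpha n A.L (A.delta t)) (A.delta t) (A.estimator t s b.1) s.1 (A.yPoint t s),
    if b.2 then A.yPoint t s else s.2)

theorem inner_succ (ω : Tape n) (t k : ℕ) :
    A.inner ω t (k + 1) = A.step t (A.inner ω t k) (ω t k) := rfl

/-- The Lyapunov function of outer iteration `t`, centered at `xs`. -/
noncomputable def lyapunov (A : Input n d) (t : ℕ) (xs : Vec d) (s : Vec d × Vec d) : ℝ :=
  bregman (average A.f) xs s.2 + lyapunovWeight n A.L (A.delta t) / 2 * ‖s.1 - xs‖ ^ 2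

theorem delta_eq (t : ℕ) : A.delta t = A.L / A.β ^ t := by
  induction t with
  | zero => simp [delta]
  | succ t ih => rw [delta, ih, pow_succ, div_div]

theorem Admissible.delta_pos (hA : A.Admissible) (t : ℕ) : 0 < A.delta t := by
  have := hA.L_pos
  have : 0 < A.β := one_pos.trans hA.β_gt
  rw [delta_eq]
  positivity

theorem Admissible.delta_le (hA : A.Admissible) (t : ℕ) : A.delta t ≤ A.L := by
  rw [delta_eq]
  exact div_le_self hA.L_pos.le (one_le_pow₀ hA.β_gt.le)

theorem Admissible.smooth_average (hA : A.Admissible) : LSmooth A.L (average A.f) :=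
  LSmooth.average hA.n_pos hA.smooth

theorem Admissible.gradient_regF (hA : A.Admissible) (t : ℕ) (i : Fin n) (x : Vec d) :
    ∇ (A.regF t i) x = ∇ (A.f i) x + A.delta t • (x - A.x₀) :=
  (hasGradientAt_regularize (hA.smooth i).1 _ _ _).gradient

theorem Admissible.gradient_average_regF (hA : A.Admissible) (t : ℕ) (x : Vec d) :
    ∇ (average (A.regF t)) x = ∇ (average A.f) x + A.delta t • (x - A.x₀) := by
  have : average (A.regF t) = regularize (A.delta t) A.x₀ (average A.f) :=
    average_regularize hA.n_pos _ _
  rw [this]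
  exact (hasGradientAt_regularize hA.smooth_average.1 _ _ _).gradient

/-- Since `τ_z = 1/(α+L+δ)` and `∇f(xs) = δ(x₀ - xs)`, the explicit `δ`-terms in `y` cancel against
the gradient of the regularizer. -/
theorem Admissible.smul_yPoint_sub {t : ℕ} {xs : Vec d} (hA : A.Admissible)
    (hxs : ∇ (average A.f) xs = A.delta t • (A.x₀ - xs)) (s : Vec d × Vec d) :
    (alpha n A.L (A.delta t) + A.L + A.delta t) • (A.yPoint t s - xs)
      = alpha n A.L (A.delta t) • (s.1 - xs) + A.L • (s.2 - xs)
        - (∇ (average A.f) s.2 - ∇ (average A.f) xs) := by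
  have ha := alpha_pos hA.n_pos hA.L_pos (hA.delta_pos t)
  have hδ := hA.delta_pos t
  have hL := hA.L_pos
  rw [yPoint, tauZ_eq hA.n_pos hL hδ, tauX, hA.gradient_average_regF, hxs]
  set a := alpha n A.L (A.delta t)
  set δ := A.delta t
  have hM : a + A.L + δ ≠ 0 := by positivity
  have e : (1 : ℝ) - (a + δ) / (a + A.L + δ) = A.L / (a + A.L + δ) := by field_simp; ring
  rw [e, smul_sub, smul_add, smul_add, smul_smul, smul_smul, smul_smul, mul_div_cancel₀ _ hM,
    mul_div_cancel₀ _ hM, mul_div_cancel₀ _ hM]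
  module

theorem Admissible.step_fst_sub {t : ℕ} {xs : Vec d} (hA : A.Admissible)
    (hxs : ∇ (average A.f) xs = A.delta t • (A.x₀ - xs)) (s : Vec d × Vec d) (b : Fin n × Bool) :
    (A.step t s b).1 - xs = (alpha n A.L (A.delta t) + A.delta t)⁻¹ •
      (alpha n A.L (A.delta t) • (s.1 - xs) - (∇ (A.f b.1) (A.yPoint t s) - ∇ (A.f b.1) s.2
        + (∇ (average A.f) s.2 - ∇ (average A.f) xs))) := by
  have ha := alpha_pos hA.n_pos hA.L_pos (hA.delta_pos t)
  have hδ := hA.delta_pos t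
  simp only [step, proxStep, estimator, hA.gradient_regF, hA.gradient_average_regF, hxs]
  set a := alpha n A.L (A.delta t)
  set δ := A.delta t
  have hM : a + δ ≠ 0 := by positivity
  rw [sub_eq_iff_eq_add, inv_smul_eq_iff₀ hM, smul_add, smul_inv_smul₀ hM]
  module


theorem sum_drawProb_mul (φ : Fin n → Bool → ℝ) :
    ∑ b : Fin n × Bool, drawProb n b * φ b.1 b.2
      = 1 / (n : ℝ) * ∑ i, (1 / (n : ℝ) * φ i true + (1 - 1 / (n : ℝ)) * φ i false) := by
  rw [Fintype.sum_prod_type, Finset.mul_sum]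
  refine Finset.sum_congr rfl fun i _ => ?_
  rw [Fintype.sum_bool]
  simp only [drawProb, if_true, Bool.false_eq_true, if_false]
  ring

/-- The recentered estimator is `H i + b`, with mean `a`. Its mean square is controlled by
cocoercivity of the components between `x̃` and `y`, so no bounded-variance assumption enters. -/
theorem Admissible.sum_drawProb_lyapunov_step_le {t : ℕ} {xs : Vec d} (hA : A.Admissible)
    (hxs : ∇ (average A.f) xs = A.delta t • (A.x₀ - xs)) (s : Vec d × Vec d) :
    ∑ b, drawProb n b * A.lyapunov t xs (A.step t s b)
      ≤ contraction n A.L (A.delta t) * A.lyapunov t xs s := by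
  have hα := alpha_pos hA.n_pos hA.L_pos (hA.delta_pos t)
  have hδ := hA.delta_pos t
  have hL := hA.L_pos
  have hn0 : (0 : ℝ) < n := by exact_mod_cast hA.n_pos
  have hconv := convexOn_average hA.convex
  have hdiff := hA.smooth_average.1
  have hfd := fun i => (hA.smooth i).1
  have hY := hA.smul_yPoint_sub hxs s
  set F := average A.f with hF
  set y := A.yPoint t s with hy
  set a := ∇ F y - ∇ F xs with ha
  set b := ∇ F s.2 - ∇ F xs with hb
  set H : Fin n → Vec d := fun i => ∇ (A.f i) y - ∇ (A.f i) s.2 with hH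
  have hmeanH : (1 / (n : ℝ)) • ∑ i, H i = a - b := by
    rw [hH, Finset.sum_sub_distrib, smul_sub, ← gradient_average hfd, ← gradient_average hfd]
    rw [ha, hb]; abel
  have hinner : ∀ w : Vec d, 1 / (n : ℝ) * ∑ i, Inner.inner ℝ (H i) w = Inner.inner ℝ (a - b) w := by
    intro w
    rw [← hmeanH, inner_smul_left, sum_inner]
    simp
  set S := 1 / (n : ℝ) * ∑ i, ‖H i + b‖ ^ 2 with hSdef
  have hSH : 1 / (n : ℝ) * ∑ i, ‖H i‖ ^ 2
      ≤ 2 * A.L * (bregman F xs s.2 - bregman F xs y - Inner.inner ℝ a ((s.2 - xs) - (y - xs))) := by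
    have h1 : ∀ i, ‖H i‖ ^ 2
        ≤ 2 * A.L * (A.f i s.2 - A.f i y - Inner.inner ℝ (∇ (A.f i) y) (s.2 - y)) := by
      intro i
      rw [hH]
      simp only
      rw [norm_sub_rev]
      exact (hA.smooth i).sq_norm_gradient_sub_le hL (hA.convex i) _ _
    have h2 : 1 / (n : ℝ) * ∑ i, 2 * A.L * (A.f i s.2 - A.f i y
        - Inner.inner ℝ (∇ (A.f i) y) (s.2 - y))
        = 2 * A.L * (F s.2 - F y - Inner.inner ℝ (∇ F y) (s.2 - y)) := by
      rw [← Finset.mul_sum, Finset.sum_sub_distrib, Finset.sum_sub_distrib, ← sum_inner,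
        hF, gradient_average hfd, inner_smul_left]
      simp only [average, conj_trivial]
      ring
    calc _ ≤ 1 / (n : ℝ) * ∑ i, 2 * A.L * (A.f i s.2 - A.f i y
        - Inner.inner ℝ (∇ (A.f i) y) (s.2 - y)) := by
          gcongr with i; exact h1 i
      _ = _ := by
          rw [h2, ha]
          simp only [bregman, inner_sub_left, inner_sub_right]
          ring
  -- Expand `‖H i + b‖²` and use that the `H i` average to `a - b`; this leaves `2⟪a, b⟫ - ‖b‖²`.
  have hSle : S ≤ 2 * A.L * (bregman F xs s.2 - bregman F xs y
      - Inner.inner ℝ a ((s.2 - xs) - (y - xs))) + 2 * Inner.inner ℝ a b - ‖b‖ ^ 2 := by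
    have e : S = 1 / (n : ℝ) * ∑ i, ‖H i‖ ^ 2 + 2 * Inner.inner ℝ (a - b) b + ‖b‖ ^ 2 := by
      rw [hSdef, ← hinner b]
      simp only [norm_add_sq_real, Finset.sum_add_distrib, ← Finset.mul_sum, Finset.sum_const,
        Finset.card_univ, Fintype.card_fin, nsmul_eq_mul]
      field_simp
    rw [e, inner_sub_left, real_inner_self_eq_norm_sq]
    linarith
  have hyY : bregman F xs y ≤ Inner.inner ℝ a (y - xs) := by
    have := gradient_inequality hconv hdiff y xs
    rw [ha, bregman, inner_sub_left]
    rw [← neg_sub y xs, inner_neg_right] at this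
    linarith
  have main := lyapunov_inequality (p := 1 / (n : ℝ)) hα hδ hL (by positivity) rfl
    (contraction_eq hA.n_pos hL hδ) hY hyY hSle
  refine le_of_eq_of_le ?_ main
  have hnorm : ∀ i c, ‖(A.step t s (i, c)).1 - xs‖ ^ 2
      = ((alpha n A.L (A.delta t) + A.delta t) ^ 2)⁻¹ *
        (alpha n A.L (A.delta t) ^ 2 * ‖s.1 - xs‖ ^ 2
          - 2 * alpha n A.L (A.delta t) * Inner.inner ℝ (H i + b) (s.1 - xs) + ‖H i + b‖ ^ 2) := by
    intro i c
    rw [hA.step_fst_sub hxs, norm_smul, mul_pow, Real.norm_of_nonneg (by positivity), inv_pow]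
    congr 1
    change ‖_ - (H i + b)‖ ^ 2 = _
    rw [norm_sub_sq_real, norm_smul, mul_pow, Real.norm_of_nonneg hα.le, inner_smul_left,
      real_inner_comm (s.1 - xs)]
    simp only [conj_trivial]
    ring
  have hsum : ∑ i, ((alpha n A.L (A.delta t) + A.delta t) ^ 2)⁻¹ *
        (alpha n A.L (A.delta t) ^ 2 * ‖s.1 - xs‖ ^ 2
          - 2 * alpha n A.L (A.delta t) * Inner.inner ℝ (H i + b) (s.1 - xs) + ‖H i + b‖ ^ 2)
      = n * (((alpha n A.L (A.delta t) + A.delta t) ^ 2)⁻¹ *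
        (alpha n A.L (A.delta t) ^ 2 * ‖s.1 - xs‖ ^ 2
          - 2 * alpha n A.L (A.delta t) * Inner.inner ℝ a (s.1 - xs) + S)) := by
    have e1 : ∑ i, Inner.inner ℝ (H i + b) (s.1 - xs) = n * Inner.inner ℝ a (s.1 - xs) := by
      have := hinner (s.1 - xs)
      rw [inner_sub_left] at this
      simp only [inner_add_left, Finset.sum_add_distrib, Finset.sum_const, Finset.card_univ,
        Fintype.card_fin, nsmul_eq_mul]
      field_simp at this
      linarith
    have e2 : ∑ i, ‖H i + b‖ ^ 2 = n * S := by rw [hSdef]; field_simp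
    rw [← Finset.mul_sum, Finset.sum_add_distrib, Finset.sum_sub_distrib, ← Finset.mul_sum,
      ← Finset.mul_sum, e1, e2]
    simp only [Finset.sum_const, Finset.card_univ, Fintype.card_fin, nsmul_eq_mul]
    ring
  have := sum_drawProb_mul (fun i c => A.lyapunov t xs (A.step t s (i, c)))
  rw [this]
  simp only [lyapunov, hnorm]
  simp only [step, if_true, Bool.false_eq_true, if_false, ← hF, ← hy]
  rw [← lyapunovWeight]
  have e : ∀ u v w x : ℝ, u * (v + w) + (1 - u) * (x + w) = (u * v + (1 - u) * x) + w := by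
    intros; ring
  simp only [e]
  rw [Finset.sum_add_distrib, ← Finset.mul_sum, hsum]
  simp only [Finset.sum_const, Finset.card_univ, Fintype.card_fin, nsmul_eq_mul]
  field_simp

theorem Admissible.bregman_nonneg (hA : A.Admissible) (u x : Vec d) :
    0 ≤ bregman (average A.f) u x := by
  have := gradient_inequality (convexOn_average hA.convex) hA.smooth_average.1 u x
  rw [bregman]
  linarith

theorem Admissible.sq_norm_gradient_sub_le (hA : A.Admissible) (t : ℕ) (xs : Vec d)
    (s : Vec d × Vec d) :
    ‖∇ (average A.f) s.2 - ∇ (average A.f) xs‖ ^ 2 ≤ 2 * A.L * A.lyapunov t xs s := by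
  have h1 := hA.smooth_average.sq_norm_gradient_sub_le hA.L_pos (convexOn_average hA.convex) s.2 xs
  have := lyapunovWeight_pos hA.n_pos hA.L_pos (hA.delta_pos t)
  have hL := hA.L_pos
  refine h1.trans ?_
  rw [← bregman, lyapunov]
  gcongr
  exact le_add_of_nonneg_right (by positivity)

/-! ### The regularized minimizer under the initial function gap. -/

section IFC

variable {Δ₀ : ℝ} {t : ℕ} {xs : Vec d}

/-- The center is a minimizer of the regularized function; `f` is at least its minimum there, so the
gap from `x₀` only shrinks. -/
theorem Admissible.exists_center (hA : A.Admissible) (hI : A.IFC Δ₀) (t : ℕ) :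
    ∃ xs, ∇ (average A.f) xs = A.delta t • (A.x₀ - xs) ∧
      average A.f A.x₀ - average A.f xs ≤ Δ₀ := by
  obtain ⟨x, hx, hΔ⟩ := hI
  obtain ⟨xs, hxs⟩ := exists_gradient_eq_smul_sub hA.smooth_average.1 hx (hA.delta_pos t) A.x₀
  exact ⟨xs, hxs, by linarith [hx xs]⟩

/-- Both summands are nonnegative for admissible input, so a bound on the function gap controls the
divergence and the distance at once. -/
theorem bregman_center (hxs : ∇ (average A.f) xs = A.delta t • (A.x₀ - xs)) :
    bregman (average A.f) xs A.x₀ + A.delta t * ‖A.x₀ - xs‖ ^ 2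
      = average A.f A.x₀ - average A.f xs := by
  rw [bregman, hxs, inner_smul_left, real_inner_self_eq_norm_sq]
  simp

theorem Admissible.sq_norm_gradient_center_le (hA : A.Admissible)
    (hxs : ∇ (average A.f) xs = A.delta t • (A.x₀ - xs))
    (hΔ : average A.f A.x₀ - average A.f xs ≤ Δ₀) :
    ‖∇ (average A.f) xs‖ ^ 2 ≤ A.delta t * Δ₀ := by
  have h1 := bregman_center hxs
  have h2 := hA.bregman_nonneg xs A.x₀
  have hδ := hA.delta_pos t
  rw [hxs, norm_smul, Real.norm_of_nonneg hδ.le, mul_pow, sq, mul_assoc]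
  gcongr
  linarith

theorem Admissible.lyapunov_start_le (hA : A.Admissible)
    (hxs : ∇ (average A.f) xs = A.delta t • (A.x₀ - xs))
    (hΔ : average A.f A.x₀ - average A.f xs ≤ Δ₀) :
    2 * A.L * A.lyapunov t xs (A.x₀, A.x₀) ≤ CIFC n A.L (A.delta t) * Δ₀ := by
  have h1 := bregman_center hxs
  have h2 := hA.bregman_nonneg xs A.x₀
  have hδ := hA.delta_pos t
  have hL := hA.L_pos
  have hw := lyapunovWeight_pos hA.n_pos hL hδ
  rw [← h1] at hΔ
  refine le_trans ?_ (mul_le_mul_of_nonneg_left hΔ ?_)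
  · rw [CIFC_eq hA.n_pos hL hδ, lyapunov]
    set w := lyapunovWeight n A.L (A.delta t)
    set h := bregman (average A.f) xs A.x₀
    set r := ‖A.x₀ - xs‖ ^ 2
    have hr : 0 ≤ r := by positivity
    have e : (2 * A.L + 2 * A.L * w / A.delta t) * (h + A.delta t * r)
        = 2 * A.L * (h + w / 2 * r) + (2 * A.L * A.delta t * r + 2 * A.L * w / A.delta t * h
          + A.L * w * r) := by
      field_simp
      ring
    rw [e]
    exact le_add_of_nonneg_right (by positivity)
  · rw [CIFC_eq hA.n_pos hL hδ]
    positivity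

end IFC

end Input

/-! ### Random variables that read finitely many finite-valued coordinates. -/

section FiniteCoordinates

variable {ι γ β β' Ω : Type*} [Nonempty γ] {S T : Finset ι}

/-- Factoring through finitely many coordinates in a finite discrete `γ` makes measurability and
integrability automatic, whatever the regularity of the functions in the algorithm. -/
theorem exists_eq_comp_restrict_of_dependsOn {F : (ι → γ) → β} (hF : DependsOn F (S : Set ι)) :
    ∃ g : (S → γ) → β, ∀ x, F x = g fun i => x i := by
  classical
  refine ⟨fun v => F fun i => if h : i ∈ S then v ⟨i, h⟩ else Classical.arbitrary γ,
    fun x => hF fun i hi => ?_⟩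
  simp [Finset.mem_coe.1 hi]

variable [Finite γ] [MeasurableSpace γ] [DiscreteMeasurableSpace γ] [MeasurableSpace Ω]
  {P : Measure Ω} {X : ι → Ω → γ}

theorem measurable_comp_of_dependsOn [MeasurableSpace β] {F : (ι → γ) → β}
    (hF : DependsOn F (S : Set ι)) (hX : ∀ i, Measurable (X i)) :
    Measurable fun ω => F fun i => X i ω := by
  obtain ⟨g, hg⟩ := exists_eq_comp_restrict_of_dependsOn hF
  simp only [hg]
  exact (Measurable.of_discrete (f := g)).comp (measurable_pi_lambda _ fun i => hX i)

theorem integrable_comp_of_dependsOn [IsFiniteMeasure P] {F : (ι → γ) → ℝ}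
    (hF : DependsOn F (S : Set ι)) (hX : ∀ i, Measurable (X i)) :
    Integrable (fun ω => F fun i => X i ω) P := by
  obtain ⟨g, hg⟩ := exists_eq_comp_restrict_of_dependsOn hF
  simp only [hg]
  have hm : Measurable fun ω => fun i : S => X i ω := measurable_pi_lambda _ fun i => hX i
  exact (Integrable.of_finite (f := g) (μ := P.map fun ω => fun i : S => X i ω)).comp_measurable hm

theorem indepFun_comp_of_dependsOn [MeasurableSpace β] [MeasurableSpace β'] {F : (ι → γ) → β}
    {G : (ι → γ) → β'} (hF : DependsOn F (S : Set ι)) (hG : DependsOn G (T : Set ι))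
    (hST : Disjoint S T) (hX : ∀ i, Measurable (X i)) (hind : iIndepFun X P) :
    IndepFun (fun ω => F fun i => X i ω) (fun ω => G fun i => X i ω) P := by
  obtain ⟨g, hg⟩ := exists_eq_comp_restrict_of_dependsOn hF
  obtain ⟨g', hg'⟩ := exists_eq_comp_restrict_of_dependsOn hG
  simp only [hg, hg']
  exact (hind.indepFun_finset S T hST hX).comp (Measurable.of_discrete (f := g))
    (Measurable.of_discrete (f := g'))

end FiniteCoordinates

/-! ### Draws read by the inner loop, and decay in expectation. -/

namespace Input

variable {n d : ℕ} {A : Input n d}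

/-- The coordinates of the tape that the first `k` inner iterations of outer iteration `t` read. -/
def innerCoords (t k : ℕ) : Finset (ℕ × ℕ) := (Finset.range k).image (Prod.mk t)

theorem mem_innerCoords {t k : ℕ} {s : ℕ × ℕ} : s ∈ innerCoords t k ↔ s.1 = t ∧ s.2 < k := by
  obtain ⟨a, b⟩ := s
  simp [innerCoords, and_comm, eq_comm]

theorem inner_congr {ω ω' : Tape n} {t k : ℕ} (h : ∀ j < k, ω t j = ω' t j) :
    A.inner ω t k = A.inner ω' t k := by
  induction k with
  | zero => rfl
  | succ k ih =>
    rw [inner_succ, inner_succ, ih fun j hj => h j (hj.trans k.lt_succ_self), h k k.lt_succ_self]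

theorem dependsOn_inner (A : Input n d) (t k : ℕ) :
    DependsOn (fun x : ℕ × ℕ → Fin n × Bool => A.inner (Function.curry x) t k)
      (innerCoords t k : Set (ℕ × ℕ)) := by
  intro x y h
  exact inner_congr fun j hj => h (t, j) (Finset.mem_coe.2 (mem_innerCoords.2 ⟨rfl, hj⟩))

theorem dependsOn_comp_inner {β : Type*} (A : Input n d) (t k : ℕ) (φ : Vec d × Vec d → β) :
    DependsOn (fun x : ℕ × ℕ → Fin n × Bool => φ (A.inner (Function.curry x) t k))
      (innerCoords t k : Set (ℕ × ℕ)) :=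
  fun _ _ h => congrArg φ (dependsOn_inner A t k h)

section Sampling

variable {Ω : Type*} [MeasurableSpace Ω] {P : Measure Ω}
  {ξ : ℕ → ℕ → Ω → Fin n × Bool}

theorem nonempty_draw (hn : 0 < n) : Nonempty (Fin n × Bool) := ⟨(⟨0, hn⟩, true)⟩

theorem integrable_comp_inner [IsProbabilityMeasure P] (hn : 0 < n) (hξ : IsSampling P ξ) (t k : ℕ)
    (φ : Vec d × Vec d → ℝ) :
    Integrable (fun ω => φ (A.inner (fun t k => ξ t k ω) t k)) P := by
  have := nonempty_draw hn
  exact integrable_comp_of_dependsOn (X := fun s : ℕ × ℕ => ξ s.1 s.2)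
    (dependsOn_comp_inner A t k φ) fun s => hξ.measurable s.1 s.2

/-- The state before iteration `k` reads only the draws `(t, j)` with `j < k`, so it is independent
of draw `(t, k)`. Splitting by the value of that draw replaces conditional expectation by a finite
sum. -/
theorem integral_comp_inner_succ [IsProbabilityMeasure P] (hn : 0 < n) (hξ : IsSampling P ξ) (t k : ℕ)
    (φ : Vec d × Vec d → ℝ) :
    ∫ ω, φ (A.inner (fun t k => ξ t k ω) t (k + 1)) ∂P
      = ∫ ω, ∑ b, drawProb n b * φ (A.step t (A.inner (fun t k => ξ t k ω) t k) b) ∂P := by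
  classical
  have := nonempty_draw hn
  have hX : ∀ s : ℕ × ℕ, Measurable (ξ s.1 s.2) := fun s => hξ.measurable s.1 s.2
  have hcoin : ∀ b, DependsOn (fun x : ℕ × ℕ → Fin n × Bool => if x (t, k) = b then (1 : ℝ) else 0)
      (({(t, k)} : Finset (ℕ × ℕ)) : Set (ℕ × ℕ)) := by
    intro b x y h
    simp only [h (t, k) (by simp)]
  have hdisj : Disjoint ({(t, k)} : Finset (ℕ × ℕ)) (innerCoords t k) := by
    rw [Finset.disjoint_singleton_left, mem_innerCoords]
    simp
  have hprob : ∀ b, ∫ ω, (if ξ t k ω = b then (1 : ℝ) else 0) ∂P = drawProb n b := by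
    intro b
    have h1 := hξ.law t k b.1 b.2
    have h2 := integral_indicator_one (μ := P) (hξ.measurable t k (measurableSet_singleton b))
    rw [drawProb, ← h1, ← h2]
    congr 1
    funext ω
    simp [Set.indicator]
  have hterm : ∀ b, ∫ ω, (if ξ t k ω = b then (1 : ℝ) else 0)
      * φ (A.step t (A.inner (fun t k => ξ t k ω) t k) b) ∂P
      = drawProb n b * ∫ ω, φ (A.step t (A.inner (fun t k => ξ t k ω) t k) b) ∂P := by
    intro b
    have hind := indepFun_comp_of_dependsOn (X := fun s : ℕ × ℕ => ξ s.1 s.2) (hcoin b)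
      (dependsOn_comp_inner A t k fun s => φ (A.step t s b)) hdisj hX hξ.indep
    rw [← hprob b]
    exact hind.integral_mul_eq_mul_integral
      (integrable_comp_of_dependsOn (hcoin b) hX).aestronglyMeasurable
      (integrable_comp_inner hn hξ t k fun s => φ (A.step t s b)).aestronglyMeasurable
  have hint : ∀ b, Integrable (fun ω => φ (A.step t (A.inner (fun t k => ξ t k ω) t k) b)) P :=
    fun b => integrable_comp_inner hn hξ t k fun s => φ (A.step t s b)
  have hint' : ∀ b, Integrable (fun ω => (if ξ t k ω = b then (1 : ℝ) else 0)
      * φ (A.step t (A.inner (fun t k => ξ t k ω) t k) b)) P := by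
    intro b
    refine (hint b).bdd_mul (c := 1)
      (integrable_comp_of_dependsOn (hcoin b) hX).aestronglyMeasurable (ae_of_all _ fun ω => ?_)
    split_ifs <;> simp
  rw [integral_finsetSum _ fun b _ => (hint b).const_mul _]
  simp only [integral_const_mul, ← hterm]
  rw [← integral_finsetSum _ fun b _ => hint' b]
  simp only [inner_succ, ite_mul, one_mul, zero_mul, Finset.sum_ite_eq, Finset.mem_univ, if_true]

theorem Admissible.integral_lyapunov_le [IsProbabilityMeasure P] (hA : A.Admissible) (hξ : IsSampling P ξ) {t : ℕ}
    {xs : Vec d} (hxs : ∇ (average A.f) xs = A.delta t • (A.x₀ - xs)) (k : ℕ) :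
    ∫ ω, A.lyapunov t xs (A.inner (fun t k => ξ t k ω) t k) ∂P
      ≤ contraction n A.L (A.delta t) ^ k * A.lyapunov t xs (A.x₀, A.x₀) := by
  induction k with
  | zero => simp [inner]
  | succ k ih =>
    rw [integral_comp_inner_succ hA.n_pos hξ]
    calc _ ≤ ∫ ω, contraction n A.L (A.delta t)
          * A.lyapunov t xs (A.inner (fun t k => ξ t k ω) t k) ∂P := by
          refine integral_mono
            (integrable_comp_inner hA.n_pos hξ t k
              fun s => ∑ b, drawProb n b * A.lyapunov t xs (A.step t s b))
            ((integrable_comp_inner hA.n_pos hξ t k (A.lyapunov t xs)).const_mul _) fun ω => ?_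
          exact hA.sum_drawProb_lyapunov_step_le hxs _
      _ ≤ _ := by
          rw [integral_const_mul, pow_succ', mul_assoc]
          exact mul_le_mul_of_nonneg_left ih
            (contraction_pos hA.n_pos hA.L_pos (hA.delta_pos t)).le

/-- Square the break test; `(1 + δ/α)^(2k)` is the reciprocal of the contraction factor to the power
`k`. -/
theorem Admissible.CIFC_mul_contraction_pow_le (hA : A.Admissible) {t k : ℕ}
    (hk : A.Breaks t k) :
    CIFC n A.L (A.delta t) * contraction n A.L (A.delta t) ^ k ≤ 2 * A.delta t := by
  have hα := alpha_pos hA.n_pos hA.L_pos (hA.delta_pos t)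
  have hδ := hA.delta_pos t
  rw [Breaks, Real.sqrt_le_left (by positivity), div_le_iff₀ (by positivity)] at hk
  have e : ((1 + A.delta t / alpha n A.L (A.delta t)) ^ k) ^ 2
      * contraction n A.L (A.delta t) ^ k = 1 := by
    rw [contraction_pow, ← mul_pow, ← mul_pow]
    have : (1 + A.delta t / alpha n A.L (A.delta t)) *
        (alpha n A.L (A.delta t) / (alpha n A.L (A.delta t) + A.delta t)) = 1 := by
      field_simp
    rw [this, one_pow, one_pow]
  have hρ := contraction_pos hA.n_pos hA.L_pos hδ
  calc _ ≤ ((1 + A.delta t / alpha n A.L (A.delta t)) ^ k) ^ 2 * (2 * A.delta t)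
        * contraction n A.L (A.delta t) ^ k := by gcongr
    _ = (((1 + A.delta t / alpha n A.L (A.delta t)) ^ k) ^ 2
        * contraction n A.L (A.delta t) ^ k) * (2 * A.delta t) := by ring
    _ = _ := by rw [e, one_mul]

theorem measurableSet_stops (hn : 0 < n) (hξ : IsSampling P ξ) (t k : ℕ) :
    MeasurableSet {ω | A.Stops (fun t k => ξ t k ω) t k} := by
  have := nonempty_draw hn
  exact measurableSet_setOfPred.2 (measurable_comp_of_dependsOn (X := fun s : ℕ × ℕ => ξ s.1 s.2)
    (dependsOn_comp_inner A t k fun s => ‖∇ (average A.f) s.2‖ ≤ A.ε)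
    fun s => hξ.measurable s.1 s.2)

/-- In an outer iteration with a small regularization parameter, the iterate at the break passes
the termination test with high probability. -/
theorem Admissible.measure_not_stops_le [IsProbabilityMeasure P] (hA : A.Admissible) (hξ : IsSampling P ξ) {Δ₀ q : ℝ}
    (hΔ : 0 < Δ₀) (hI : A.IFC Δ₀) (hq : 0 < q) (hq1 : q < 1) {t k : ℕ}
    (ht : A.delta t ≤ A.ε ^ 2 * q ^ 2 / (8 * Δ₀)) (hk : A.Breaks t k) :
    P.real {ω | ¬ A.Stops (fun t k => ξ t k ω) t k} ≤ q := by
  obtain ⟨xs, hxs, hgap⟩ := hA.exists_center hI t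
  have hδ := hA.delta_pos t
  have hε := hA.ε_pos
  have hL := hA.L_pos
  have hδΔ : 8 * (A.delta t * Δ₀) ≤ (A.ε * q) ^ 2 := by
    rw [le_div_iff₀ (by positivity)] at ht
    nlinarith
  set G : Vec d × Vec d → ℝ := fun s => ‖∇ (average A.f) s.2 - ∇ (average A.f) xs‖ ^ 2 with hG
  have hGint := integrable_comp_inner (A := A) hA.n_pos hξ t k G
  have hmean : ∫ ω, G (A.inner (fun t k => ξ t k ω) t k) ∂P ≤ (A.ε * q / 2) ^ 2 := by
    calc _ ≤ ∫ ω, 2 * A.L * A.lyapunov t xs (A.inner (fun t k => ξ t k ω) t k) ∂P := by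
          refine integral_mono hGint
            ((integrable_comp_inner hA.n_pos hξ t k (A.lyapunov t xs)).const_mul _) fun ω => ?_
          exact hA.sq_norm_gradient_sub_le t xs _
      _ ≤ 2 * A.L * (contraction n A.L (A.delta t) ^ k * A.lyapunov t xs (A.x₀, A.x₀)) := by
          rw [integral_const_mul]
          exact mul_le_mul_of_nonneg_left (hA.integral_lyapunov_le hξ hxs k) (by positivity)
      _ = contraction n A.L (A.delta t) ^ k * (2 * A.L * A.lyapunov t xs (A.x₀, A.x₀)) := by ring
      _ ≤ contraction n A.L (A.delta t) ^ k * (CIFC n A.L (A.delta t) * Δ₀) :=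
          mul_le_mul_of_nonneg_left (hA.lyapunov_start_le hxs hgap)
            (pow_nonneg (contraction_pos hA.n_pos hL hδ).le k)
      _ = (CIFC n A.L (A.delta t) * contraction n A.L (A.delta t) ^ k) * Δ₀ := by ring
      _ ≤ 2 * A.delta t * Δ₀ :=
          mul_le_mul_of_nonneg_right (hA.CIFC_mul_contraction_pow_le hk) hΔ.le
      _ ≤ _ := by nlinarith
  have hcenter : ‖∇ (average A.f) xs‖ ≤ A.ε * q / 2 := by
    apply le_of_sq_le_sq _ (by positivity)
    have := hA.sq_norm_gradient_center_le hxs hgap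
    have : 0 < A.delta t * Δ₀ := by positivity
    nlinarith
  -- A failed test means `‖∇f(x̃)‖ > ε`, while `‖∇f(xs)‖ ≤ εq/2`; the difference of the gradients
  -- must then exceed `ε(1 - q/2)`.
  set c := (A.ε * (1 - q / 2)) ^ 2 with hc
  have hcpos : 0 < c := by
    have : 0 < 1 - q / 2 := by linarith
    positivity
  have hsub : {ω | ¬ A.Stops (fun t k => ξ t k ω) t k}
      ⊆ {ω | c ≤ G (A.inner (fun t k => ξ t k ω) t k)} := by
    intro ω hω
    simp only [Set.mem_ofPred_eq, Stops, not_le] at hω ⊢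
    have h1 := norm_le_norm_sub_add (∇ (average A.f) (A.inner (fun t k => ξ t k ω) t k).2)
      (∇ (average A.f) xs)
    rw [hc, hG]
    apply pow_le_pow_left₀
    · exact mul_nonneg hε.le (by linarith)
    · linarith
  have hmarkov := mul_meas_ge_le_integral_of_nonneg (μ := P)
    (ae_of_all _ fun ω => by simp only [hG]; positivity) hGint c
  have h1 : c * P.real {ω | ¬ A.Stops (fun t k => ξ t k ω) t k} ≤ c * q := by
    calc _ ≤ c * P.real {ω | c ≤ G (A.inner (fun t k => ξ t k ω) t k)} := by
          gcongr
          exact measure_ne_top _ _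
      _ ≤ (A.ε * q / 2) ^ 2 := hmarkov.trans hmean
      _ ≤ c * q := by
          -- Here `q < 1` suffices, since then `(2 - q)² > 1 > q`.
          have e : c * q - (A.ε * q / 2) ^ 2 = A.ε ^ 2 * q / 4 * ((2 - q) ^ 2 - q) := by
            rw [hc]; ring
          have : 0 ≤ A.ε ^ 2 * q / 4 * ((2 - q) ^ 2 - q) :=
            mul_nonneg (by positivity) (by nlinarith)
          linarith
  exact le_of_mul_le_mul_left h1 hcpos

end Sampling

/-! ### Control flow: break index, entering an outer iteration, and the draws it reads. -/

section Control

theorem Admissible.exists_breaks (hA : A.Admissible) (t : ℕ) : ∃ k, A.Breaks t k := by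
  have hα := alpha_pos hA.n_pos hA.L_pos (hA.delta_pos t)
  have hδ := hA.delta_pos t
  have h : 1 < 1 + A.delta t / alpha n A.L (A.delta t) := by
    have : 0 < A.delta t / alpha n A.L (A.delta t) := by positivity
    linarith
  obtain ⟨k, hk⟩ := pow_unbounded_of_one_lt
    (√(CIFC n A.L (A.delta t) / (2 * A.delta t))) h
  exact ⟨k, hk.le⟩

/-- The first inner iteration of outer iteration `t` in which the test for a break succeeds. -/
noncomputable def breakIndex (A : Input n d) (t : ℕ) : ℕ := sInf {k | A.Breaks t k}

theorem Admissible.breaks_breakIndex (hA : A.Admissible) (t : ℕ) :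
    A.Breaks t (A.breakIndex t) :=
  Nat.sInf_mem (hA.exists_breaks t)

theorem not_breaks_of_lt_breakIndex {t k : ℕ} (hk : k < A.breakIndex t) : ¬ A.Breaks t k :=
  Nat.notMem_of_lt_sInf hk

theorem Admissible.le_breakIndex_of_executes (hA : A.Admissible) {ω : Tape n} {t k : ℕ}
    (h : A.Executes ω t k) : k ≤ A.breakIndex t := by
  by_contra! hk
  exact (h _ hk).2 (hA.breaks_breakIndex t)

/-- The first success of the termination test is executed, because no break test succeeds before it.
At the break index itself, termination takes precedence. -/
theorem exists_executes_stops {ω : Tape n} {t k : ℕ} (hk : k ≤ A.breakIndex t)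
    (h : A.Stops ω t k) : ∃ j, A.Executes ω t j ∧ A.Stops ω t j := by
  classical
  have hex : ∃ j, A.Stops ω t j := ⟨k, h⟩
  refine ⟨Nat.find hex, fun j hj => ⟨Nat.find_min hex hj, ?_⟩, Nat.find_spec hex⟩
  exact not_breaks_of_lt_breakIndex (hj.trans_le ((Nat.find_min' hex h).trans hk))

theorem Admissible.reaches_succ_of_not_terminatesAt (hA : A.Admissible) {ω : Tape n} {t : ℕ}
    (hr : A.Reaches ω t) (hT : ¬ A.TerminatesAt ω t) : A.Reaches ω (t + 1) := by
  have hns : ∀ k ≤ A.breakIndex t, ¬ A.Stops ω t k :=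
    fun k hk hs => hT ⟨hr, exists_executes_stops hk hs⟩
  exact ⟨hr, A.breakIndex t, fun j hj => ⟨hns j hj.le, not_breaks_of_lt_breakIndex hj⟩,
    hns _ le_rfl, hA.breaks_breakIndex t⟩

theorem Admissible.reaches_of_not_terminatesAt (hA : A.Admissible) {ω : Tape n} {t : ℕ}
    (h : ∀ s < t, ¬ A.TerminatesAt ω s) : A.Reaches ω t := by
  induction t with
  | zero => trivial
  | succ t ih =>
    exact hA.reaches_succ_of_not_terminatesAt (ih fun s hs => h s (hs.trans t.lt_succ_self))
      (h t t.lt_succ_self)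

/-- The coordinates of the tape that decide whether outer iteration `t` is entered. -/
noncomputable def reachCoords (A : Input n d) (t : ℕ) : Finset (ℕ × ℕ) :=
  (Finset.range t).biUnion fun s => innerCoords s (A.breakIndex s)

theorem mem_reachCoords {t : ℕ} {s : ℕ × ℕ} :
    s ∈ A.reachCoords t ↔ s.1 < t ∧ s.2 < A.breakIndex s.1 := by
  simp only [reachCoords, Finset.mem_biUnion, Finset.mem_range, mem_innerCoords]
  constructor
  · rintro ⟨a, ha, rfl, h⟩
    exact ⟨ha, h⟩
  · rintro ⟨h1, h2⟩
    exact ⟨s.1, h1, rfl, h2⟩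

/-- Break indices are deterministic, so entering iteration `t` is decided by the draws before the
break index in each earlier row. -/
theorem Admissible.reaches_of_agree (hA : A.Admissible) {ω ω' : Tape n} {t : ℕ}
    (h : ∀ s < t, ∀ j < A.breakIndex s, ω s j = ω' s j) (hr : A.Reaches ω t) :
    A.Reaches ω' t := by
  induction t with
  | zero => trivial
  | succ t ih =>
    obtain ⟨h1, k, hex, hs, hb⟩ := hr
    have hk := hA.le_breakIndex_of_executes hex
    have hin : ∀ j ≤ k, A.inner ω t j = A.inner ω' t j := fun j hj =>
      inner_congr fun i hi => h t t.lt_succ_self i (hi.trans_le (hj.trans hk))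
    refine ⟨ih (fun s hs => h s (hs.trans t.lt_succ_self)) h1, k, fun j hj => ?_, ?_, hb⟩
    · have := hex j hj
      rwa [Stops, hin j hj.le] at this
    · rwa [Stops, hin k le_rfl] at hs

theorem Admissible.dependsOn_reaches (hA : A.Admissible) (t : ℕ) :
    DependsOn (fun x : ℕ × ℕ → Fin n × Bool => A.Reaches (Function.curry x) t)
      (A.reachCoords t : Set (ℕ × ℕ)) := by
  intro x y h
  have h' : ∀ s < t, ∀ j < A.breakIndex s, x (s, j) = y (s, j) := fun s hs j hj =>
    h (s, j) (Finset.mem_coe.2 (mem_reachCoords.2 ⟨hs, hj⟩))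
  exact propext ⟨hA.reaches_of_agree h', hA.reaches_of_agree fun s hs j hj => (h' s hs j hj).symm⟩

end Control

/-! ### Termination probabilities. -/

section Termination

variable {Ω : Type*} [MeasurableSpace Ω] {P : Measure Ω}
  {ξ : ℕ → ℕ → Ω → Fin n × Bool} {Δ₀ q : ℝ} {ℓ : ℕ}

theorem Admissible.measurableSet_reaches (hA : A.Admissible) (hξ : IsSampling P ξ) (t : ℕ) :
    MeasurableSet {ω | A.Reaches (fun t k => ξ t k ω) t} := by
  have := nonempty_draw hA.n_pos
  exact measurableSet_setOfPred.2 (measurable_comp_of_dependsOn (X := fun s : ℕ × ℕ => ξ s.1 s.2)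
    (hA.dependsOn_reaches t) fun s => hξ.measurable s.1 s.2)

/-- The two events read disjoint sets of rows of the tape: those before `t`, and row `t`. -/
theorem Admissible.measure_reaches_inter_stops (hA : A.Admissible) (hξ : IsSampling P ξ)
    (t k : ℕ) :
    P ({ω | A.Reaches (fun t k => ξ t k ω) t} ∩ {ω | A.Stops (fun t k => ξ t k ω) t k})
      = P {ω | A.Reaches (fun t k => ξ t k ω) t} * P {ω | A.Stops (fun t k => ξ t k ω) t k} := by
  have := nonempty_draw hA.n_pos
  have hdisj : Disjoint (A.reachCoords t) (innerCoords t k) := by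
    rw [Finset.disjoint_left]
    intro s hs hs'
    rw [mem_reachCoords] at hs
    rw [mem_innerCoords] at hs'
    omega
  have hind := indepFun_comp_of_dependsOn (X := fun s : ℕ × ℕ => ξ s.1 s.2)
    (hA.dependsOn_reaches t) (dependsOn_comp_inner A t k fun s => ‖∇ (average A.f) s.2‖ ≤ A.ε)
    hdisj (fun s => hξ.measurable s.1 s.2) hξ.indep
  have := hind.measure_inter_preimage_eq_mul {True} {True} (measurableSet_singleton _)
    (measurableSet_singleton _)
  have e : ∀ p : Ω → Prop, p ⁻¹' {True} = {ω | p ω} := by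
    intro p
    ext ω
    simp
  rw [e, e] at this
  exact this

theorem Admissible.one_sub_le_cond_terminatesAt [IsProbabilityMeasure P] (hA : A.Admissible) (hξ : IsSampling P ξ)
    (hΔ : 0 < Δ₀) (hI : A.IFC Δ₀) (hq : 0 < q) (hq1 : q < 1)
    (hℓ : A.delta ℓ ≤ A.ε ^ 2 * q ^ 2 / (8 * Δ₀))
    (hR : P {ω | A.Reaches (fun t k => ξ t k ω) ℓ} ≠ 0) :
    1 - q ≤ (P[|{ω | A.Reaches (fun t k => ξ t k ω) ℓ}]).real
      {ω | A.TerminatesAt (fun t k => ξ t k ω) ℓ} := by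
  set K := A.breakIndex ℓ with hK
  set R := {ω | A.Reaches (fun t k => ξ t k ω) ℓ} with hRdef
  set S := {ω | A.Stops (fun t k => ξ t k ω) ℓ K} with hS
  have hSm : MeasurableSet S := measurableSet_stops hA.n_pos hξ ℓ K
  have h1 : 1 - q ≤ P.real S := by
    have := hA.measure_not_stops_le hξ hΔ hI hq hq1 hℓ (hA.breaks_breakIndex ℓ)
    have h2 : P.real Sᶜ ≤ q := this
    rw [probReal_compl_eq_one_sub hSm] at h2
    linarith
  have hsub : R ∩ S ⊆ {ω | A.TerminatesAt (fun t k => ξ t k ω) ℓ} := fun ω hω =>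
    ⟨hω.1, exists_executes_stops le_rfl hω.2⟩
  have hcond : (P[|R]).real S = P.real S := by
    rw [measureReal_def, cond_apply (hA.measurableSet_reaches hξ ℓ),
      hA.measure_reaches_inter_stops hξ, ← mul_assoc,
      ENNReal.inv_mul_cancel hR (measure_ne_top _ _), one_mul, measureReal_def]
  have hcond' : (P[|R]).real (R ∩ S) = (P[|R]).real S := by
    rw [measureReal_def, measureReal_def, cond_inter_self (hA.measurableSet_reaches hξ ℓ)]
  have := cond_isProbabilityMeasure hR
  calc 1 - q ≤ (P[|R]).real (R ∩ S) := by rw [hcond', hcond]; exact h1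
    _ ≤ _ := measureReal_mono hsub (measure_ne_top _ _)

/-- The test at the break index of row `ℓ` is an event even on runs that never enter iteration `ℓ`.
When it succeeds, the algorithm has either terminated earlier or enters `ℓ` and terminates there, so
no conditioning is needed. -/
theorem Admissible.one_sub_le_terminates [IsProbabilityMeasure P] (hA : A.Admissible) (hξ : IsSampling P ξ)
    (hΔ : 0 < Δ₀) (hI : A.IFC Δ₀) (hq : 0 < q) (hq1 : q < 1)
    (hℓ : A.delta ℓ ≤ A.ε ^ 2 * q ^ 2 / (8 * Δ₀)) :
    1 - q ≤ P.real {ω | ∃ t ≤ ℓ, A.TerminatesAt (fun t k => ξ t k ω) t} := by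
  set S := {ω | A.Stops (fun t k => ξ t k ω) ℓ (A.breakIndex ℓ)} with hS
  have hSm : MeasurableSet S := measurableSet_stops hA.n_pos hξ ℓ _
  have h1 : P.real Sᶜ ≤ q :=
    hA.measure_not_stops_le hξ hΔ hI hq hq1 hℓ (hA.breaks_breakIndex ℓ)
  rw [probReal_compl_eq_one_sub hSm] at h1
  have hsub : S ⊆ {ω | ∃ t ≤ ℓ, A.TerminatesAt (fun t k => ξ t k ω) t} := by
    intro ω hω
    by_contra hno
    simp only [Set.mem_ofPred_eq, not_exists, not_and] at hno
    exact hno ℓ le_rfl ⟨hA.reaches_of_not_terminatesAt fun s hs => hno s hs.le,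
      exists_executes_stops le_rfl hω⟩
  have := measureReal_mono hsub (measure_ne_top P _)
  linarith

end Termination

end Input

/-! ### Size of `α` and of the constant in the break test. -/

section Parameters

variable {n : ℕ} {L δ : ℝ}

/-- Cleared of denominators, the root equation is `(α+δ)³ = n(2α+δ)δ(α+L+δ)`; bound `2α+δ` by
`2(α+δ)` and cancel. -/
theorem sq_alpha_ratio_le (hn : 0 < n) (hL : 0 < L) (hδ : 0 < δ) :
    ((alpha n L δ + δ) / δ) ^ 2 ≤ 2 * n * ((alpha n L δ + δ) / δ + L / δ) := by
  have ha := alpha_pos hn hL hδ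
  have hn0 : (0 : ℝ) < n := by exact_mod_cast hn
  have h := contraction_eq hn hL hδ
  rw [contraction] at h
  set a := alpha n L δ
  have h1 : (a + δ) ^ 3 = n * (2 * a + δ) * δ * (a + L + δ) := by
    field_simp at h
    linear_combination h
  have h2 : (a + δ) ^ 2 ≤ 2 * n * δ * (a + L + δ) := by
    have : (a + δ) * (a + δ) ^ 2 ≤ (a + δ) * (2 * n * δ * (a + L + δ)) := by
      have : 0 ≤ n * δ * δ * (a + L + δ) := by positivity
      nlinarith
    exact le_of_mul_le_mul_left this (by positivity)
  have e : 2 * n * ((a + δ) / δ + L / δ) = 2 * n * δ * (a + L + δ) / δ ^ 2 := by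
    field_simp
    ring
  rw [e, div_pow]
  gcongr

theorem alpha_ratio_le (hn : 0 < n) (hL : 0 < L) (hδ : 0 < δ) :
    (alpha n L δ + δ) / δ ≤ 2 * n + √(2 * n * (L / δ)) := by
  have h := sq_alpha_ratio_le hn hL hδ
  have hn0 : (0 : ℝ) < n := by exact_mod_cast hn
  have hw := Real.sq_sqrt (show 0 ≤ 2 * n * (L / δ) by positivity)
  have hw0 := Real.sqrt_nonneg (2 * n * (L / δ))
  set v := (alpha n L δ + δ) / δ
  set w := √(2 * n * (L / δ))
  -- With `w² = 2nL/δ`, the previous bound reads `v² ≤ 2nv + w²`. If `v > 2n + w`, then `(v-w)(v-2n)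
  -- ≤ w(w+2n-v) ≤ 0`, although both factors are positive.
  by_contra! hlt
  nlinarith [mul_pos (show 0 < v - w by linarith) (show 0 < v - 2 * n by linarith)]

theorem CIFC_div_le (hn : 0 < n) (hL : 0 < L) (hδ : 0 < δ) :
    CIFC n L δ / (2 * δ) ≤ 3 * (L / δ) := by
  have ha := alpha_pos hn hL hδ
  have hn0 : (0 : ℝ) < n := by exact_mod_cast hn
  have h := sq_alpha_ratio_le hn hL hδ
  rw [CIFC_eq hn hL hδ]
  have hw : lyapunovWeight n L δ / δ ≤ 2 := by
    rw [lyapunovWeight]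
    set a := alpha n L δ
    have e : 1 / (n : ℝ) * (a + δ) ^ 2 / (a + L + δ) / δ
        = ((a + δ) / δ) ^ 2 / (n * ((a + δ) / δ + L / δ)) := by
      field_simp
      ring
    rw [e, div_le_iff₀ (by positivity)]
    linarith
  have e : (2 * L + 2 * L * lyapunovWeight n L δ / δ) / (2 * δ)
      = L / δ * (1 + lyapunovWeight n L δ / δ) := by
    field_simp
  rw [e, mul_comm 3]
  gcongr
  linarith

end Parameters

/-! ### Length and expected cost of an outer iteration. -/

namespace Input

variable {n d : ℕ} {A : Input n d}

/-- The length of the inner loop of an outer iteration. -/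
theorem Admissible.breakIndex_le (hA : A.Admissible) (t : ℕ) :
    (A.breakIndex t : ℝ) ≤ (2 * n + √(2 * n * (A.L / A.delta t)))
      * (Real.log (A.L / A.delta t) + 1) + 1 := by
  have hα := alpha_pos hA.n_pos hA.L_pos (hA.delta_pos t)
  have hδ := hA.delta_pos t
  have hL := hA.L_pos
  have hκ : 1 ≤ A.L / A.delta t := (one_le_div hδ).2 (hA.delta_le t)
  have hlog : 0 ≤ Real.log (A.L / A.delta t) := Real.log_nonneg hκ
  rcases Nat.eq_zero_or_pos (A.breakIndex t) with h0 | hpos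
  · rw [h0]
    push_cast
    positivity
  -- The break test still fails at the predecessor of the break index, which bounds `k`; this
  -- accounts for the final `+ 1`.
  obtain ⟨k, hk⟩ := Nat.exists_eq_succ_of_ne_zero hpos.ne'
  have hnb : ¬ A.Breaks t k := not_breaks_of_lt_breakIndex (by omega)
  rw [Breaks, not_le] at hnb
  have h1 := hnb.trans_le (Real.sqrt_le_sqrt (CIFC_div_le hA.n_pos hL hδ))
  have hratio := alpha_ratio_le hA.n_pos hL hδ
  set a := alpha n A.L (A.delta t)
  set δ := A.delta t
  have hlog1 : δ / (a + δ) ≤ Real.log (1 + δ / a) := by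
    have := Real.log_le_sub_one_of_pos (show 0 < (1 + δ / a)⁻¹ by positivity)
    rw [Real.log_inv] at this
    have e : (1 + δ / a)⁻¹ = 1 - δ / (a + δ) := by
      field_simp
      ring
    rw [e] at this
    linarith
  have h2 : k * Real.log (1 + δ / a) ≤ Real.log (A.L / δ) + 1 := by
    have := Real.log_le_log (by positivity) h1.le
    rw [Real.log_pow, Real.log_sqrt (by positivity), Real.log_mul (by norm_num) (by positivity)]
      at this
    -- `log 3 ≤ 2` gives `log √(3κ) ≤ log κ + 1` for `κ = L/δ ≥ 1`.
    have h3 := Real.log_le_sub_one_of_pos (show (0 : ℝ) < 3 by norm_num)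
    linarith
  have h3 : (k : ℝ) * (δ / (a + δ)) ≤ Real.log (A.L / δ) + 1 :=
    (mul_le_mul_of_nonneg_left hlog1 k.cast_nonneg).trans h2
  have h4 : (k : ℝ) ≤ (a + δ) / δ * (Real.log (A.L / δ) + 1) := by
    calc (k : ℝ) = (a + δ) / δ * (k * (δ / (a + δ))) := by field_simp
      _ ≤ _ := by gcongr
  have h5 : (a + δ) / δ * (Real.log (A.L / δ) + 1)
      ≤ (2 * n + √(2 * n * (A.L / δ))) * (Real.log (A.L / δ) + 1) := by gcongr
  rw [hk]
  push_cast
  linarith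

theorem Admissible.outer_cost_le (hA : A.Admissible) (t : ℕ) :
    n + 3 * ((A.breakIndex t : ℝ) + 1)
      ≤ 13 * (n + √(n * A.β ^ t)) * (t * Real.log A.β + 1) := by
  have h := hA.breakIndex_le t
  have hL := hA.L_pos
  have hβ : 0 < A.β := one_pos.trans hA.β_gt
  have hn1 : (1 : ℝ) ≤ n := by exact_mod_cast hA.n_pos
  have e : A.L / A.delta t = A.β ^ t := by
    rw [delta_eq]
    field_simp
  rw [e, Real.log_pow] at h
  have hlog : 0 ≤ t * Real.log A.β := mul_nonneg t.cast_nonneg (Real.log_pos hA.β_gt).le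
  have hs : √(2 * n * A.β ^ t) ≤ 2 * √(n * A.β ^ t) := by
    rw [Real.sqrt_le_left (by positivity), mul_pow, Real.sq_sqrt (by positivity)]
    have : 0 < n * A.β ^ t := by positivity
    linarith
  have hw := Real.sqrt_nonneg (n * A.β ^ t)
  set w := √(n * A.β ^ t)
  set l := t * Real.log A.β
  have : (2 * n + √(2 * n * A.β ^ t)) * (l + 1) ≤ (2 * n + 2 * w) * (l + 1) := by gcongr
  nlinarith [mul_nonneg hw hlog, mul_nonneg (zero_le_one.trans hn1) hlog]

/-! ### Expected number of component gradients. -/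

section Calls

variable {Ω : Type*} [MeasurableSpace Ω] {P : Measure Ω} {ξ : ℕ → ℕ → Ω → Fin n × Bool}

/-- Dropping the execution conditions leaves a deterministic number of terms. The range ends at the
break index inclusive, since the breaking iteration is executed and paid for. -/
theorem Admissible.outerCalls_le (hA : A.Admissible) (ω : Tape n) (t : ℕ) :
    A.outerCalls ω t ≤ n + ∑ k ∈ Finset.range (A.breakIndex t + 1),
      (2 + if (ω t k).2 then (n : ℝ≥0∞) else 0) := by
  classical
  rw [outerCalls]
  split_ifs
  · gcongr
    rw [tsum_eq_sum (s := Finset.range (A.breakIndex t + 1))]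
    · refine Finset.sum_le_sum fun k _ => ?_
      split_ifs <;> simp
    · intro k hk
      rw [if_neg]
      intro hex
      have := hA.le_breakIndex_of_executes hex
      rw [Finset.mem_range] at hk
      omega
  · exact zero_le

theorem lintegral_coin_le [IsProbabilityMeasure P] (hn : 0 < n) (hξ : IsSampling P ξ) (t k : ℕ) :
    ∫⁻ ω, (if (ξ t k ω).2 then (n : ℝ≥0∞) else 0) ∂P ≤ 1 := by
  have hn0 : (0 : ℝ) < n := by exact_mod_cast hn
  have hset : MeasurableSet {ω | (ξ t k ω).2 = true} :=
    hξ.measurable t k (MeasurableSet.of_discrete (s := {b : Fin n × Bool | b.2 = true}))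
  have e : ∀ ω, (if (ξ t k ω).2 then (n : ℝ≥0∞) else 0)
      = {ω | (ξ t k ω).2 = true}.indicator (fun _ => (n : ℝ≥0∞)) ω := by
    intro ω
    simp [Set.indicator]
  simp only [e]
  rw [lintegral_indicator_const hset]
  have hsub : {ω | (ξ t k ω).2 = true} ⊆ ⋃ i : Fin n, ξ t k ⁻¹' {(i, true)} := by
    intro ω hω
    refine Set.mem_iUnion.2 ⟨(ξ t k ω).1, ?_⟩
    have h2 : (ξ t k ω).2 = true := hω
    rw [Set.mem_preimage, Set.mem_singleton_iff, ← h2]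
  have hle : P {ω | (ξ t k ω).2 = true} ≤ (n : ℝ≥0∞)⁻¹ := by
    calc _ ≤ P (⋃ i : Fin n, ξ t k ⁻¹' {(i, true)}) := measure_mono hsub
      _ ≤ ∑ i : Fin n, P (ξ t k ⁻¹' {(i, true)}) := measure_iUnion_fintype_le _ _
      _ = ∑ _i : Fin n, ENNReal.ofReal (1 / n * (1 / n)) := by
          refine Finset.sum_congr rfl fun i _ => ?_
          have := hξ.law t k i true
          rw [if_pos rfl] at this
          rw [← this, measureReal_def, ENNReal.ofReal_toReal (measure_ne_top _ _)]
      _ = (n : ℝ≥0∞)⁻¹ := by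
          rw [Finset.sum_const, Finset.card_univ, Fintype.card_fin, ← ENNReal.ofReal_nsmul,
            nsmul_eq_mul, ← ENNReal.ofReal_natCast, ← ENNReal.ofReal_inv_of_pos hn0]
          congr 1
          field_simp
  calc _ ≤ (n : ℝ≥0∞) * (n : ℝ≥0∞)⁻¹ := by gcongr
    _ ≤ 1 := ENNReal.mul_inv_le_one _

theorem Admissible.lintegral_totalCalls_le [IsProbabilityMeasure P] (hA : A.Admissible)
    (hξ : IsSampling P ξ) (ℓ : ℕ) :
    ∫⁻ ω, A.totalCalls (fun t k => ξ t k ω) ℓ ∂P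
      ≤ ENNReal.ofReal (∑ t ∈ Finset.range (ℓ + 1), (n + 3 * ((A.breakIndex t : ℝ) + 1))) := by
  have hmeas : ∀ t k, Measurable fun ω => (if (ξ t k ω).2 then (n : ℝ≥0∞) else 0) := fun t k =>
    (Measurable.of_discrete (f := fun b : Fin n × Bool => if b.2 then (n : ℝ≥0∞) else 0)).comp
      (hξ.measurable t k)
  have hmeas' : ∀ t, Measurable fun ω => ∑ k ∈ Finset.range (A.breakIndex t + 1),
      (2 + if (ξ t k ω).2 then (n : ℝ≥0∞) else 0) := fun t =>
    Finset.measurable_fun_sum _ fun k _ => (hmeas t k).const_add 2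
  have hbound : ∀ t, ∫⁻ ω, (n + ∑ k ∈ Finset.range (A.breakIndex t + 1),
      (2 + if (ξ t k ω).2 then (n : ℝ≥0∞) else 0)) ∂P
      ≤ ENNReal.ofReal (n + 3 * ((A.breakIndex t : ℝ) + 1)) := by
    intro t
    have hk : ∀ k, ∫⁻ ω, (2 + if (ξ t k ω).2 then (n : ℝ≥0∞) else 0) ∂P ≤ 3 := by
      intro k
      rw [lintegral_add_left measurable_const, lintegral_const, measure_univ, mul_one]
      calc _ ≤ (2 : ℝ≥0∞) + 1 := add_le_add le_rfl (lintegral_coin_le hA.n_pos hξ t k)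
        _ = 3 := two_add_one_eq_three
    rw [lintegral_add_left measurable_const, lintegral_const, measure_univ, mul_one,
      lintegral_finsetSum _ fun k _ => (hmeas t k).const_add 2,
      ENNReal.ofReal_add (by positivity) (by positivity), ENNReal.ofReal_natCast]
    refine add_le_add le_rfl ((Finset.sum_le_sum fun k _ => hk k).trans_eq ?_)
    have e : 3 * ((A.breakIndex t : ℝ) + 1) = (((A.breakIndex t + 1) * 3 : ℕ) : ℝ) := by
      push_cast
      ring
    rw [e, ENNReal.ofReal_natCast, Finset.sum_const, Finset.card_range, nsmul_eq_mul]
    push_cast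
    rfl
  have hpoint : ∀ ω, A.totalCalls (fun t k => ξ t k ω) ℓ ≤ ∑ t ∈ Finset.range (ℓ + 1),
      (n + ∑ k ∈ Finset.range (A.breakIndex t + 1),
        (2 + if (ξ t k ω).2 then (n : ℝ≥0∞) else 0)) := by
    intro ω
    rw [totalCalls]
    exact Finset.sum_le_sum fun t _ => hA.outerCalls_le _ t
  rw [ENNReal.ofReal_sum_of_nonneg fun t _ => by positivity]
  refine (lintegral_mono hpoint).trans ?_
  rw [lintegral_finsetSum _ fun t _ => (hmeas' t).const_add _]
  exact Finset.sum_le_sum fun t _ => hbound t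

end Calls

end Input

/-! ### Summation over the outer iterations. -/

/-- A constant for the expected oracle complexity. -/
noncomputable def complexityConst (β : ℝ) : ℝ :=
  13 * (Real.log (8 * β) + 3) * ((Real.log (8 * β) + 3) / Real.log β + 1
    + √β / (√β - 1) * √(8 * β))

theorem complexityConst_nonneg {β : ℝ} (hβ : 1 < β) : 0 ≤ complexityConst β := by
  have h1 : 0 < Real.log β := Real.log_pos hβ
  have h2 : 0 < Real.log (8 * β) := Real.log_pos (by linarith)
  have h3 : 0 < √β - 1 := by
    rw [sub_pos, Real.lt_sqrt zero_le_one]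
    linarith
  unfold complexityConst
  positivity

/-- The `n`-terms contribute the number of outer iterations, of order `max 1 (log r)`; the
`√(nβ^t)`-terms form a geometric sum of order `√n * r`. A common logarithmic factor bounds the inner
loops. -/
theorem sum_outer_cost_le {β r : ℝ} (hβ : 1 < β) (hr : 0 < r) (n ℓ : ℕ)
    (hℓ : β ^ ℓ ≤ β * (8 * r ^ 2)) :
    ∑ t ∈ Finset.range (ℓ + 1), 13 * (n + √(n * β ^ t)) * (t * Real.log β + 1)
      ≤ complexityConst β * ((n * max 1 (Real.log r) + √n * r) * max 1 (Real.log r)) := by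
  have hβ0 : 0 < β := one_pos.trans hβ
  have hlogβ : 0 < Real.log β := Real.log_pos hβ
  have hlog8 : 0 < Real.log (8 * β) := Real.log_pos (by linarith)
  set b := √β with hb
  have hb1 : 1 < b := by
    rw [hb, Real.lt_sqrt zero_le_one]
    linarith
  have hb0 : 0 < b := one_pos.trans hb1
  set m := max 1 (Real.log r) with hm
  have hm1 : 1 ≤ m := le_max_left _ _
  set D := Real.log (8 * β) + 3 with hD
  -- `ℓ log β ≤ log (8β) + 2 log r`; since `m ≥ 1`, the `2 log r` and the `1` together cost `3m`,
  -- hence the `3` in `D`.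
  have hlog : ℓ * Real.log β + 1 ≤ D * m := by
    have h1 := Real.log_le_log (by positivity) hℓ
    have e : β * (8 * r ^ 2) = 8 * β * r ^ 2 := by ring
    rw [Real.log_pow, e, Real.log_mul (by positivity) (by positivity), Real.log_pow] at h1
    have h2 : Real.log r ≤ m := le_max_right _ _
    push_cast at h1
    rw [hD]
    nlinarith
  have hcount : (ℓ : ℝ) + 1 ≤ (D / Real.log β + 1) * m := by
    have : (ℓ : ℝ) ≤ D / Real.log β * m := by
      rw [div_mul_eq_mul_div, le_div_iff₀ hlogβ]
      linarith
    linarith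
  have hbl : b ^ ℓ ≤ √(8 * β) * r := by
    apply le_of_sq_le_sq _ (by positivity)
    rw [← pow_mul, mul_comm, pow_mul, hb, Real.sq_sqrt hβ0.le, mul_pow,
      Real.sq_sqrt (by positivity)]
    linarith
  have hgeom : ∑ t ∈ Finset.range (ℓ + 1), b ^ t ≤ b / (b - 1) * √(8 * β) * r := by
    rw [geom_sum_eq hb1.ne', div_le_iff₀ (by linarith)]
    have e : b / (b - 1) * √(8 * β) * r * (b - 1) = b * (√(8 * β) * r) := by
      have : b - 1 ≠ 0 := by linarith
      field_simp
    rw [e, pow_succ']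
    nlinarith
  have hterm : ∀ t ∈ Finset.range (ℓ + 1), 13 * (n + √(n * β ^ t)) * (t * Real.log β + 1)
      ≤ 13 * (D * m) * (n + √n * b ^ t) := by
    intro t ht
    have htl : (t : ℝ) ≤ ℓ := by
      exact_mod_cast Nat.lt_succ_iff.1 (Finset.mem_range.1 ht)
    have e : √(n * β ^ t) = √n * b ^ t := by
      rw [Real.sqrt_mul (by positivity), hb]
      congr 1
      rw [Real.sqrt_eq_iff_mul_self_eq (by positivity) (by positivity), ← mul_pow,
        Real.mul_self_sqrt hβ0.le]
    have h1 : t * Real.log β + 1 ≤ D * m := by nlinarith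
    rw [e]
    have h2 : 0 ≤ 13 * (n + √n * b ^ t) := by positivity
    nlinarith
  have hD0 : 0 < D := by linarith
  have hb2 : 0 < b - 1 := by linarith
  calc _ ≤ ∑ t ∈ Finset.range (ℓ + 1), 13 * (D * m) * (n + √n * b ^ t) :=
        Finset.sum_le_sum hterm
    _ = 13 * (D * m) * (n * (ℓ + 1) + √n * ∑ t ∈ Finset.range (ℓ + 1), b ^ t) := by
        rw [← Finset.mul_sum, Finset.sum_add_distrib, ← Finset.mul_sum, Finset.sum_const,
          Finset.card_range, nsmul_eq_mul]
        push_cast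
        ring
    _ ≤ 13 * (D * m) * (n * ((D / Real.log β + 1) * m) + √n * (b / (b - 1) * √(8 * β) * r)) := by
        gcongr
    _ ≤ 13 * (D * m) * ((D / Real.log β + 1 + b / (b - 1) * √(8 * β)) * (n * m + √n * r)) := by
        gcongr
        have h1 : 0 ≤ b / (b - 1) * √(8 * β) * (n * m) := by positivity
        have h2 : 0 ≤ (D / Real.log β + 1) * (√n * r) := by positivity
        linarith
    _ = _ := by rw [complexityConst, ← hD, ← hb]; ring

/-! ### The index `ℓ` and the final complexity bound. -/

namespace Input

variable {n d : ℕ} {A : Input n d} {Ω : Type*} [MeasurableSpace Ω] {P : Measure Ω}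
  {ξ : ℕ → ℕ → Ω → Fin n × Bool} {Δ₀ q : ℝ} {ℓ : ℕ}

theorem Admissible.L_div_threshold (hA : A.Admissible) (hΔ : 0 < Δ₀) (hq : 0 < q) :
    A.L / (A.ε ^ 2 * q ^ 2 / (8 * Δ₀)) = 8 * (√(A.L * Δ₀) / (A.ε * q)) ^ 2 := by
  have hε := hA.ε_pos
  have hL := hA.L_pos
  rw [div_pow, Real.sq_sqrt (by positivity)]
  field_simp

theorem Admissible.lintegral_totalCalls_le_max [IsProbabilityMeasure P] (hA : A.Admissible)
    (hξ : IsSampling P ξ) (hΔ : 0 < Δ₀) (hq : 0 < q)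
    (hℓ : IsLeast {t : ℕ | A.delta t ≤ A.ε ^ 2 * q ^ 2 / (8 * Δ₀)} ℓ)
    (hle : A.ε ^ 2 * q ^ 2 / (8 * Δ₀) ≤ A.L) :
    ∫⁻ ω, A.totalCalls (fun t k => ξ t k ω) ℓ ∂P ≤ ENNReal.ofReal
      (complexityConst A.β * ((n * max 1 (Real.log (√(A.L * Δ₀) / (A.ε * q)))
        + √(n * A.L * Δ₀) / (A.ε * q)) * max 1 (Real.log (√(A.L * Δ₀) / (A.ε * q))))) := by
  have hε := hA.ε_pos
  have hL := hA.L_pos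
  have hβ : 0 < A.β := one_pos.trans hA.β_gt
  refine (hA.lintegral_totalCalls_le hξ ℓ).trans (ENNReal.ofReal_le_ofReal ?_)
  refine (Finset.sum_le_sum fun t _ => hA.outer_cost_le t).trans ?_
  have e : √(n * A.L * Δ₀) / (A.ε * q) = √n * (√(A.L * Δ₀) / (A.ε * q)) := by
    rw [mul_assoc, Real.sqrt_mul (by positivity), mul_div_assoc]
  rw [e]
  refine sum_outer_cost_le hA.β_gt (by positivity) n ℓ ?_
  rw [← hA.L_div_threshold hΔ hq]
  set τ := A.ε ^ 2 * q ^ 2 / (8 * Δ₀)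
  have hτ : 0 < τ := by positivity
  rcases ℓ with _ | t
  -- For `ℓ = 0` there is no previous iteration above the threshold, so `δ⋆ ≤ L` takes over.
  · have : 1 ≤ A.L / τ := (one_le_div hτ).2 hle
    rw [pow_zero]
    nlinarith [hA.β_gt]
  · have h1 : ¬ A.delta t ≤ τ := fun h => absurd (hℓ.2 h) (by omega)
    rw [not_le, delta_eq, lt_div_iff₀ (by positivity)] at h1
    rw [pow_succ']
    have : A.β ^ t ≤ A.L / τ := by
      rw [le_div_iff₀ hτ]
      linarith
    gcongr

end Input

end RAccSVRG

theorem mainTheorem10 (β : ℝ) (hβ : 1 < β) :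
    ∃ C : ℝ, ∃ C' : ℝ → ℝ, ∀ (n d : ℕ) (A : RAccSVRG.Input n d), A.β = β → A.Admissible →
      ∀ (Ω : Type*) (_ : MeasurableSpace Ω) (P : Measure Ω) (_ : IsProbabilityMeasure P)
        (ξ : ℕ → ℕ → Ω → Fin n × Bool), RAccSVRG.IsSampling P ξ →
      ∀ (Δ₀ q : ℝ) (ℓ : ℕ), 0 < Δ₀ → A.IFC Δ₀ → 0 < q → q < 1 →
        IsLeast {t : ℕ | A.delta t ≤ A.ε ^ 2 * q ^ 2 / (8 * Δ₀)} ℓ →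
        -- given that outer iteration `ℓ` is entered, the algorithm terminates in it
        (P {ω | A.Reaches (fun t k => ξ t k ω) ℓ} ≠ 0 →
          1 - q ≤ (P[|{ω | A.Reaches (fun t k => ξ t k ω) ℓ}]).real
            {ω | A.TerminatesAt (fun t k => ξ t k ω) ℓ}) ∧
        -- the algorithm has terminated by the end of outer iteration `ℓ`
        1 - q ≤ P.real {ω | ∃ t ≤ ℓ, A.TerminatesAt (fun t k => ξ t k ω) t} ∧
        -- complexity of the outer iterations `0, …, ℓ`
        (A.ε ^ 2 * q ^ 2 / (8 * Δ₀) ≤ A.L →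
          ∫⁻ ω, A.totalCalls (fun t k => ξ t k ω) ℓ ∂P ≤ ENNReal.ofReal
            (C * ((n * max 1 (Real.log (√(A.L * Δ₀) / (A.ε * q)))
                + √(n * A.L * Δ₀) / (A.ε * q)) * max 1 (Real.log (√(A.L * Δ₀) / (A.ε * q)))))) ∧
        (∀ c : ℝ, 1 < c → c ≤ √(A.L * Δ₀) / (A.ε * q) →
          ∫⁻ ω, A.totalCalls (fun t k => ξ t k ω) ℓ ∂P ≤ ENNReal.ofReal
            (C' c * ((n * Real.log (√(A.L * Δ₀) / (A.ε * q))
                + √(n * A.L * Δ₀) / (A.ε * q)) * Real.log (√(A.L * Δ₀) / (A.ε * q))))) := by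
  refine ⟨RAccSVRG.complexityConst β,
    -- For `r ≥ c`, `max 1 (log r) ≤ max 1 (1 / log c) * log r`; the logarithm enters twice, hence
    -- the square.
    fun c => RAccSVRG.complexityConst β * max 1 (1 / Real.log c) ^ 2, ?_⟩
  intro n d A hAβ hA Ω _ P _ ξ hξ Δ₀ q ℓ hΔ hI hq hq1 hℓ
  refine ⟨hA.one_sub_le_cond_terminatesAt hξ hΔ hI hq hq1 hℓ.1,
    hA.one_sub_le_terminates hξ hΔ hI hq hq1 hℓ.1, fun hle => ?_, fun c hc hr => ?_⟩
  · rw [← hAβ]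
    exact hA.lintegral_totalCalls_le_max hξ hΔ hq hℓ hle
  · have hε := hA.ε_pos
    have hL := hA.L_pos
    -- Automatic here: `L/δ⋆ = 8r²` and `r ≥ c > 1`.
    have hle : A.ε ^ 2 * q ^ 2 / (8 * Δ₀) ≤ A.L := by
      rw [← one_le_div (by positivity), hA.L_div_threshold hΔ hq]
      nlinarith
    refine (hA.lintegral_totalCalls_le_max hξ hΔ hq hℓ hle).trans
      (ENNReal.ofReal_le_ofReal ?_)
    simp only [hAβ]
    rw [mul_assoc (RAccSVRG.complexityConst β)]
    refine mul_le_mul_of_nonneg_left ?_ (RAccSVRG.complexityConst_nonneg hβ)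
    have hs : 0 ≤ √(n * A.L * Δ₀) / (A.ε * q) := by positivity
    set r := √(A.L * Δ₀) / (A.ε * q)
    set s := √(n * A.L * Δ₀) / (A.ε * q)
    set M := max 1 (1 / Real.log c)
    have hlogc : 0 < Real.log c := Real.log_pos hc
    have hlogr : Real.log c ≤ Real.log r := Real.log_le_log (by linarith) hr
    have hM1 : 1 ≤ M := le_max_left _ _
    have hm : max 1 (Real.log r) ≤ M * Real.log r := by
      refine max_le ?_ (le_mul_of_one_le_left (by linarith) hM1)
      calc 1 = 1 / Real.log c * Real.log c := by field_simp
        _ ≤ M * Real.log r := by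
          gcongr
          exact le_max_right _ _
    have hlogr0 : 0 < Real.log r := hlogc.trans_le hlogr
    calc (n * max 1 (Real.log r) + s) * max 1 (Real.log r)
        ≤ (n * (M * Real.log r) + M * s) * (M * Real.log r) := by
          gcongr
          exact le_mul_of_one_le_left hs hM1
      _ = M ^ 2 * ((n * Real.log r + s) * Real.log r) := by ring
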